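/- Let $N\in\mathbb N$, let $A=(a_1,\dots,a_N)\in\mathbb R^N$ with $a_1<\dots<a_N$, let $P,Q\in\mathbb R^N$ and $T>0$. For $X\in\mathbb R^N$ and a permutation $\sigma\in\mathfrak S_N$ write $X^\sigma=(x_{\sigma(1)},\dots,x_{\sigma(N)})$, and set $$f(X)=\max_{\sigma\in\mathfrak S_N}X\cdot A^\sigma .$$ Let $\overline\nabla f(X)$ be the element of minimal Euclidean norm of the subdifferential $\partial f(X)=\{p\in\mathbb R^N : f(X)+p\cdot(Y-X)\le f(Y)\ \text{for all } Y\in\mathbb R^N\}$. For a curve $Z:[0,T]\to\mathbb R^N$ define $$\Lambda'(Z)=\int_0^T\Big\{|\dot Z_t|^2+|Z_t-\overline\nabla f(Z_t)|^2\Big\}\,dt$$ if $Z\in H^1([0,T];\mathbb R^N)$ (that is, $Z$ is absolutely continuous with square-integrable derivative), $Z_0\in\{P^\sigma:\sigma\in\mathfrak S_N\}$ and $Z_T\in\{Q^\sigma:\sigma\in\mathfrak S_N\}$, and $\Lambda'(Z)=+\infty$ otherwise. For $X\in\mathbb R^N$ let $\pi(X)$ be the partition of $\{1,\dots,N\}$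 into the classes of the equivalence relation $i\sim j\Leftrightarrow x_i=x_j$. Let $Z$ be a global minimizer of $\Lambda'$. Then $Z$ is continuous on $[0,T]$, and there are finitely many times $$0=t_0<t_1<\dots<t_p=T$$ such that, for each $i=1,\dots,p$, $Z$ is smooth ($C^\infty$, up to the endpoints) on $[t_{i-1},t_i]$ and $t\mapsto\pi(Z_t)$ is constant on $(t_{i-1},t_i)$. In particular, only finitely many sticking or separation events occur: the set of times $t\in[0,T]$ such that $s\mapsto\pi(Z_s)$ is not constant on any neighbourhood of $t$ in $[0,T]$ is finite. -/

import Mathlib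

open Set MeasureTheory
open scoped ContDiff ENNReal InnerProductSpace

noncomputable section

namespace StickyAction

section ExtendedGradient

variable {E : Type*} [NormedAddCommGroup E] [InnerProductSpace ℝ E]

/-- The subdifferential `∂h(x)` of a real-valued function `h` at `x`. -/
def subdifferential (h : E → ℝ) (x : E) : Set E :=
  {p | ∀ y, h x + ⟪p, y - x⟫_ℝ ≤ h y}

/-- `p` is an element of minimal norm of `∂h(x)`. -/
def IsExtendedGradient (h : E → ℝ) (x p : E) : Prop :=
  p ∈ subdifferential h x ∧ ∀ q ∈ subdifferential h x, ‖p‖ ≤ ‖q‖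

/-- The extended gradient of `h` at `x`: the element of `∂h(x)` of minimal norm. It exists and is
unique whenever `E` is complete and `∂h(x)` is non-empty, see `extendedGradient_eq_iff`. -/
def extendedGradient (h : E → ℝ) (x : E) : E :=
  Classical.epsilon (IsExtendedGradient h x)

theorem convex_subdifferential (h : E → ℝ) (x : E) : Convex ℝ (subdifferential h x) := by
  intro p hp q hq a b ha hb hab y
  have h1 := mul_le_mul_of_nonneg_left (hp y) ha
  have h2 := mul_le_mul_of_nonneg_left (hq y) hb
  have hb' : b = 1 - a := by linarith
  subst hb'
  rw [inner_add_left, real_inner_smul_left, real_inner_smul_left]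
  nlinarith

theorem isClosed_subdifferential (h : E → ℝ) (x : E) : IsClosed (subdifferential h x) := by
  have : subdifferential h x = ⋂ y, {p | h x + ⟪p, y - x⟫_ℝ ≤ h y} := by
    ext p
    simp [subdifferential]
  rw [this]
  refine isClosed_iInter fun y => isClosed_le ?_ continuous_const
  fun_prop

theorem exists_isExtendedGradient [CompleteSpace E] {h : E → ℝ} {x : E}
    (hne : (subdifferential h x).Nonempty) : ∃ p, IsExtendedGradient h x p := by
  obtain ⟨p, hp, hp'⟩ := exists_norm_eq_iInf_of_complete_convex hne
    (isClosed_subdifferential h x).isComplete (convex_subdifferential h x) 0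
  refine ⟨p, hp, fun q hq => ?_⟩
  have hb : BddBelow (range fun w : subdifferential h x => ‖(0 : E) - w‖) :=
    ⟨0, by rintro _ ⟨w, rfl⟩; positivity⟩
  have := ciInf_le hb ⟨q, hq⟩
  rw [← hp'] at this
  simpa using this

theorem IsExtendedGradient.unique {h : E → ℝ} {x p q : E}
    (hp : IsExtendedGradient h x p) (hq : IsExtendedGradient h x q) : p = q := by
  have hpq : ‖p‖ = ‖q‖ := le_antisymm (hp.2 q hq.1) (hq.2 p hp.1)
  have hm := hp.2 _ (convex_subdifferential h x hp.1 hq.1 (by norm_num : (0 : ℝ) ≤ 1 / 2)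
    (by norm_num : (0 : ℝ) ≤ 1 / 2) (by norm_num))
  rw [← smul_add, norm_smul] at hm
  norm_num at hm
  have h1 := parallelogram_law_with_norm ℝ p q
  have h2 : ‖p - q‖ * ‖p - q‖ ≤ 0 := by
    nlinarith [norm_nonneg p, norm_nonneg q, norm_nonneg (p + q)]
  have h3 : ‖p - q‖ = 0 := by nlinarith [norm_nonneg (p - q)]
  exact sub_eq_zero.mp (norm_eq_zero.mp h3)

theorem extendedGradient_eq_iff [CompleteSpace E] {h : E → ℝ} {x : E}
    (hne : (subdifferential h x).Nonempty) (p : E) :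
    extendedGradient h x = p ↔ IsExtendedGradient h x p := by
  have hs : IsExtendedGradient h x (extendedGradient h x) :=
    Classical.epsilon_spec (exists_isExtendedGradient hne)
  exact ⟨fun e => e ▸ hs, fun hp => hs.unique hp⟩

end ExtendedGradient

variable {N : ℕ}

/-- `X^σ = (x_{σ(1)}, …, x_{σ(N)})`. -/
def permute (X : EuclideanSpace ℝ (Fin N)) (σ : Equiv.Perm (Fin N)) :
    EuclideanSpace ℝ (Fin N) :=
  WithLp.toLp 2 fun i => X (σ i)

/-- `f(X) = max_σ X · A^σ`. -/
def maxCorrelation (A X : EuclideanSpace ℝ (Fin N)) : ℝ :=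
  Finset.univ.sup' Finset.univ_nonempty fun σ : Equiv.Perm (Fin N) => ⟪X, permute A σ⟫_ℝ

theorem subdifferential_maxCorrelation_nonempty (A X : EuclideanSpace ℝ (Fin N)) :
    (subdifferential (maxCorrelation A) X).Nonempty := by
  obtain ⟨σ, -, hσ⟩ := Finset.exists_mem_eq_sup' (Finset.univ_nonempty)
    fun σ : Equiv.Perm (Fin N) => ⟪X, permute A σ⟫_ℝ
  refine ⟨permute A σ, fun Y => ?_⟩
  have h1 : maxCorrelation A X = ⟪X, permute A σ⟫_ℝ := hσ
  have h2 : ⟪Y, permute A σ⟫_ℝ ≤ maxCorrelation A Y :=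
    Finset.le_sup' (fun σ : Equiv.Perm (Fin N) => ⟪Y, permute A σ⟫_ℝ) (Finset.mem_univ σ)
  rw [h1, inner_sub_right, real_inner_comm Y, real_inner_comm X]
  linarith

/-- The extended gradient of `f` is really the element of minimal norm of `∂f(X)`. -/
theorem isExtendedGradient_maxCorrelation (A X : EuclideanSpace ℝ (Fin N)) :
    IsExtendedGradient (maxCorrelation A) X (extendedGradient (maxCorrelation A) X) :=
  (extendedGradient_eq_iff (subdifferential_maxCorrelation_nonempty A X) _).mp rfl

/-- `Z ∈ H¹([0, T]; ℝᴺ)`: in one time variable, `Z` is absolutely continuous on `[0, T]` and its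
(almost everywhere defined) derivative is square integrable there. Only the values of `Z` on
`[0, T]` matter. -/
def MemH1 (T : ℝ) (Z : ℝ → EuclideanSpace ℝ (Fin N)) : Prop :=
  AbsolutelyContinuousOnInterval Z 0 T ∧ MemLp (deriv Z) 2 (volume.restrict (Ioo 0 T))

/-- The endpoint constraint `Z_0 ∈ {P^σ}`, `Z_T ∈ {Q^σ}`. -/
def HasEndpoints (P Q : EuclideanSpace ℝ (Fin N)) (T : ℝ)
    (Z : ℝ → EuclideanSpace ℝ (Fin N)) : Prop :=
  Z 0 ∈ range (permute P) ∧ Z T ∈ range (permute Q)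

open Classical in
/-- The action `Λ'(Z) = ∫₀ᵀ (|Ż_t|² + |Z_t - ∇̄f(Z_t)|²) dt` if `Z ∈ H¹` satisfies the endpoint
constraint, and `+∞` otherwise. -/
def action (A P Q : EuclideanSpace ℝ (Fin N)) (T : ℝ)
    (Z : ℝ → EuclideanSpace ℝ (Fin N)) : ℝ≥0∞ :=
  if MemH1 T Z ∧ HasEndpoints P Q T Z then
    ∫⁻ t in Ioo 0 T, ENNReal.ofReal
      (‖deriv Z t‖ ^ 2 + ‖Z t - extendedGradient (maxCorrelation A) (Z t)‖ ^ 2)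
  else ⊤

/-- `Z` is a global minimizer of `Λ'`. -/
def IsGlobalMinimizer (A P Q : EuclideanSpace ℝ (Fin N)) (T : ℝ)
    (Z : ℝ → EuclideanSpace ℝ (Fin N)) : Prop :=
  ∀ Y : ℝ → EuclideanSpace ℝ (Fin N), action A P Q T Z ≤ action A P Q T Y

/-- `π(X)`: the partition of the set of indices into the classes of `i ∼ j ↔ x_i = x_j`. -/
def collisionPartition (X : EuclideanSpace ℝ (Fin N)) : Set (Set (Fin N)) :=
  (Setoid.ker fun i => X i).classes

end StickyAction

end

/-!
The potential energy `|X - ∇̄f(X)|²` splits as `smoothEnergy A X + clusterEnergy A X`. The first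
term `|X|² - 2 f(X)` is locally Lipschitz. The second one, `|∇̄f(X)|²`, only depends on the weak
order of the coordinates of `X` (`clusterEnergy_congr`), hence takes finitely many values, and it
decreases strictly when clusters are merged (`weakOrder_eq_of_clusterEnergy_le`). A finer weak
order therefore costs a definite amount of energy per unit of time, whereas over a short time `δ`
the Lipschitz term is of order `δ` times the distance of the curves which are compared. Points
close to `X` have a finer weak order than `X`, and if `Z_d` has a finer weak order than `Z_c`, then
the chord from `Z_c` to `Z_d` has the weak order of `Z_d` as soon as it has left `Z_c`. This makes
straight and broken lines efficient competitors, and no other ones are needed to exclude an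
accumulation of events.

Fix a time `t` and let `γ` be the smallest value which `clusterEnergy A (Z s)` takes for
arbitrarily small `s - t > 0`; call `s` good if the value at `s` is `γ`. Comparison with the chord
over `[t, s]` for good `s` shows that `Z` is within `O((s - t)²)` of that chord and that good times
are abundant (`IsLocalMinimizer.chord_estimate`, `IsLocalMinimizer.exists_good_time`). Along a
sequence of good times decaying geometrically the slopes of the chords converge, so `Z` has a right
velocity `w` with a quadratic remainder (`IsLocalMinimizer.exists_right_velocity`). A broken line
starting in the direction `w` shows that at good times the weak order of `Z` is the one of
`Z_t + δ w` (`IsLocalMinimizer.compare_brokenLine`). Finally, a maximal interval of times which are not good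
has endpoints with the same weak order, and the chord between them does better
(`IsLocalMinimizer.exists_clusterEnergy_le`). Thus the weak order is constant on a right
neighbourhood of `t`, and by time reversal on a left neighbourhood; compactness of `[0, T]` leaves
finitely many events.

Between two events the action is a strictly convex quadratic functional, for perturbations small
enough to preserve the weak order, and `Z` is identified with an explicit solution of `Y'' = Y - p`
(`IsLocalMinimizer.eq_hyperbolicArc`), which is smooth up to the endpoints.
-/

noncomputable section

namespace StickyAction

variable {N : ℕ}

/-! ### The function `f`, its subdifferential and the cluster energy -/

theorem inner_permute_le (A X : EuclideanSpace ℝ (Fin N)) (σ : Equiv.Perm (Fin N)) :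
    ⟪X, permute A σ⟫_ℝ ≤ maxCorrelation A X :=
  Finset.le_sup' (fun σ : Equiv.Perm (Fin N) => ⟪X, permute A σ⟫_ℝ) (Finset.mem_univ σ)

theorem exists_maxCorrelation_eq (A X : EuclideanSpace ℝ (Fin N)) :
    ∃ σ, maxCorrelation A X = ⟪X, permute A σ⟫_ℝ := by
  obtain ⟨σ, -, hσ⟩ := Finset.exists_mem_eq_sup' (Finset.univ_nonempty)
    fun σ : Equiv.Perm (Fin N) => ⟪X, permute A σ⟫_ℝ
  exact ⟨σ, hσ⟩

theorem inner_eq_sum (X Y : EuclideanSpace ℝ (Fin N)) : ⟪X, Y⟫_ℝ = ∑ i, X i * Y i := by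
  simp [PiLp.inner_apply, mul_comm]

theorem inner_permute_permute (X Y : EuclideanSpace ℝ (Fin N)) (τ : Equiv.Perm (Fin N)) :
    ⟪permute X τ, permute Y τ⟫_ℝ = ⟪X, Y⟫_ℝ := by
  rw [inner_eq_sum, inner_eq_sum]
  exact Equiv.sum_comp τ fun i => X i * Y i

theorem norm_permute (X : EuclideanSpace ℝ (Fin N)) (σ : Equiv.Perm (Fin N)) :
    ‖permute X σ‖ = ‖X‖ := by
  have h := inner_permute_permute X X σ
  rw [real_inner_self_eq_norm_sq, real_inner_self_eq_norm_sq] at h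
  exact (sq_eq_sq₀ (norm_nonneg _) (norm_nonneg _)).1 h

theorem permute_permute (X : EuclideanSpace ℝ (Fin N)) (σ τ : Equiv.Perm (Fin N)) :
    permute (permute X σ) τ = permute X (σ * τ) := by
  ext i; simp [permute]

theorem permute_one (X : EuclideanSpace ℝ (Fin N)) : permute X 1 = X := by
  ext i; simp [permute]

theorem maxCorrelation_permute (A X : EuclideanSpace ℝ (Fin N)) (τ : Equiv.Perm (Fin N)) :
    maxCorrelation A (permute X τ) = maxCorrelation A X := by
  have key : ∀ (X : EuclideanSpace ℝ (Fin N)) (τ : Equiv.Perm (Fin N)),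
      maxCorrelation A X ≤ maxCorrelation A (permute X τ) := by
    intro X τ
    obtain ⟨σ, hσ⟩ := exists_maxCorrelation_eq A X
    rw [hσ, ← inner_permute_permute X _ τ, permute_permute]
    exact inner_permute_le _ _ _
  refine le_antisymm ?_ (key X τ)
  have h := key (permute X τ) τ⁻¹
  rwa [permute_permute, mul_inv_cancel, permute_one] at h

theorem maxCorrelation_add_le (A X Y : EuclideanSpace ℝ (Fin N)) :
    maxCorrelation A (X + Y) ≤ maxCorrelation A X + maxCorrelation A Y := by
  obtain ⟨σ, hσ⟩ := exists_maxCorrelation_eq A (X + Y)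
  rw [hσ, inner_add_left]
  exact add_le_add (inner_permute_le A X σ) (inner_permute_le A Y σ)

theorem maxCorrelation_le_norm (A X : EuclideanSpace ℝ (Fin N)) :
    maxCorrelation A X ≤ ‖A‖ * ‖X‖ := by
  obtain ⟨σ, hσ⟩ := exists_maxCorrelation_eq A X
  rw [hσ, ← norm_permute A σ, mul_comm]
  exact real_inner_le_norm _ _

theorem abs_maxCorrelation_sub_le (A X Y : EuclideanSpace ℝ (Fin N)) :
    |maxCorrelation A X - maxCorrelation A Y| ≤ ‖A‖ * ‖X - Y‖ := by
  have h1 := maxCorrelation_add_le A (X - Y) Y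
  have h2 := maxCorrelation_add_le A (Y - X) X
  have h3 := maxCorrelation_le_norm A (X - Y)
  have h4 := maxCorrelation_le_norm A (Y - X)
  rw [sub_add_cancel] at h1 h2
  rw [norm_sub_rev] at h4
  rw [abs_le]
  constructor <;> linarith

theorem maxCorrelation_zero (A : EuclideanSpace ℝ (Fin N)) : maxCorrelation A 0 = 0 := by
  obtain ⟨σ, hσ⟩ := exists_maxCorrelation_eq A 0
  rw [hσ, inner_zero_left]

/-- Since `f` is sublinear, `∂f(X)` is the face of `∂f(0)` on which the linear form `X` attains
its maximum `f(X)`. -/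
theorem mem_subdifferential_iff {A X p : EuclideanSpace ℝ (Fin N)} :
    p ∈ subdifferential (maxCorrelation A) X ↔
      (∀ Y, ⟪p, Y⟫_ℝ ≤ maxCorrelation A Y) ∧ ⟪p, X⟫_ℝ = maxCorrelation A X := by
  constructor
  · intro h
    have h0 := h 0
    rw [maxCorrelation_zero, zero_sub, inner_neg_right] at h0
    have hle : ∀ Y, ⟪p, Y⟫_ℝ ≤ maxCorrelation A Y := by
      intro Y
      have h1 := h (X + Y)
      have h2 := maxCorrelation_add_le A X Y
      rw [add_sub_cancel_left] at h1
      linarith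
    exact ⟨hle, le_antisymm (hle X) (by linarith)⟩
  · rintro ⟨h1, h2⟩ Y
    rw [inner_sub_right, h2]
    linarith [h1 Y]

/-- The weak order of the coordinates of `X`: the pairs `(i, j)` with `x_i ≤ x_j`. Inclusion
`weakOrder X ⊆ weakOrder X'` says that `X'` is obtained from `X` by merging clusters. -/
def weakOrder (X : EuclideanSpace ℝ (Fin N)) : Set (Fin N × Fin N) :=
  {q | X q.1 ≤ X q.2}

theorem mem_weakOrder {X : EuclideanSpace ℝ (Fin N)} {i j : Fin N} :
    (i, j) ∈ weakOrder X ↔ X i ≤ X j := Iff.rfl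

theorem eq_of_weakOrder_subset {X X' : EuclideanSpace ℝ (Fin N)} (h : weakOrder X ⊆ weakOrder X')
    {i j : Fin N} (hij : X i = X j) : X' i = X' j :=
  le_antisymm (h (mem_weakOrder.2 hij.le)) (h (mem_weakOrder.2 hij.ge))

theorem collisionPartition_congr {X X' : EuclideanSpace ℝ (Fin N)}
    (h : weakOrder X = weakOrder X') : collisionPartition X = collisionPartition X' := by
  have : (Setoid.ker fun i => X i) = Setoid.ker fun i => X' i := by
    ext i j
    simp only [Setoid.ker_def]
    exact ⟨eq_of_weakOrder_subset h.subset, eq_of_weakOrder_subset h.superset⟩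
  rw [collisionPartition, collisionPartition, this]

/-- Points close to `X` have a finer weak order than `X`. -/
theorem eventually_weakOrder_subset (X : EuclideanSpace ℝ (Fin N)) :
    ∀ᶠ Y in nhds X, weakOrder Y ⊆ weakOrder X := by
  have h : ∀ q : Fin N × Fin N, ∀ᶠ Y in nhds X, q ∈ weakOrder Y → q ∈ weakOrder X := by
    rintro ⟨i, j⟩
    by_cases hX : X i ≤ X j
    · exact Filter.Eventually.of_forall fun _ _ => hX
    · have hc : Continuous fun Y : EuclideanSpace ℝ (Fin N) => Y i - Y j := by fun_prop
      have : ∀ᶠ Y in nhds X, 0 < Y i - Y j :=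
        hc.continuousAt.eventually (lt_mem_nhds (by push Not at hX; linarith))
      filter_upwards [this] with Y hY hYle
      rw [mem_weakOrder] at hYle
      linarith
  filter_upwards [Filter.eventually_all.2 h] with Y hY q hq using hY q hq

/-- If `Y` has a finer weak order than `X`, then so has the whole half-open segment from `X` to
`Y`: its points all have the weak order of `Y`. -/
theorem weakOrder_combo {X Y : EuclideanSpace ℝ (Fin N)} (h : weakOrder Y ⊆ weakOrder X)
    {a b : ℝ} (ha : 0 ≤ a) (hb : 0 < b) : weakOrder (a • X + b • Y) = weakOrder Y := by
  ext ⟨i, j⟩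
  simp only [mem_weakOrder, PiLp.add_apply, PiLp.smul_apply, smul_eq_mul]
  constructor
  · intro hle
    by_contra hlt
    push Not at hlt
    have := mul_le_mul_of_nonneg_left (h (mem_weakOrder.2 hlt.le) : X j ≤ X i) ha
    have := mul_lt_mul_of_pos_left hlt hb
    linarith
  · intro hle
    have := mul_le_mul_of_nonneg_left (h (mem_weakOrder.2 hle) : X i ≤ X j) ha
    have := mul_le_mul_of_nonneg_left hle hb.le
    linarith

/-- One permutation realises the maximum defining `f` simultaneously at all points whose weak
order is coarser than that of `X`. -/
theorem exists_perm_maxCorrelation {A : EuclideanSpace ℝ (Fin N)} (hA : StrictMono fun i => A i)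
    (X : EuclideanSpace ℝ (Fin N)) :
    ∃ σ, ∀ X', weakOrder X ⊆ weakOrder X' → maxCorrelation A X' = ⟪X', permute A σ⟫_ℝ := by
  refine ⟨(Tuple.sort fun i => X i)⁻¹, fun X' h => le_antisymm ?_ (inner_permute_le _ _ _)⟩
  set σ := (Tuple.sort fun i => X i)⁻¹ with hσ
  have hmono : Monovary (fun i => X' i) fun i => A (σ i) := by
    intro i j hij
    have h1 : σ i < σ j := hA.lt_iff_lt.1 hij
    have h2 := Tuple.monotone_sort (fun i => X i) h1.le
    refine h (mem_weakOrder.2 ?_)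
    simpa [hσ] using h2
  obtain ⟨τ, hτ⟩ := exists_maxCorrelation_eq A X'
  rw [hτ, inner_eq_sum, inner_eq_sum]
  have h3 := hmono.sum_mul_comp_perm_le_sum_mul (σ := σ⁻¹ * τ)
  simpa [permute] using h3

/-- Merging clusters enlarges the subdifferential of `f`. -/
theorem subdifferential_subset {A : EuclideanSpace ℝ (Fin N)} (hA : StrictMono fun i => A i)
    {X X' : EuclideanSpace ℝ (Fin N)} (h : weakOrder X ⊆ weakOrder X') :
    subdifferential (maxCorrelation A) X ⊆ subdifferential (maxCorrelation A) X' := by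
  intro p hp
  rw [mem_subdifferential_iff] at hp ⊢
  refine ⟨hp.1, le_antisymm (hp.1 _) ?_⟩
  -- `X` is the sum of `ε X'` and of a point which is ordered like `X`; `f` is additive on them.
  have hε : ∀ᶠ ε : ℝ in nhdsWithin 0 (Ioi 0), weakOrder X ⊆ weakOrder (X - ε • X') := by
    have hc : Filter.Tendsto (fun ε : ℝ => X - ε • X') (nhdsWithin 0 (Ioi 0)) (nhds X) := by
      have : Continuous fun ε : ℝ => X - ε • X' := by fun_prop
      simpa using (this.tendsto 0).mono_left nhdsWithin_le_nhds
    filter_upwards [hc.eventually (eventually_weakOrder_subset X)] with ε hε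
    rintro ⟨i, j⟩ hij
    rcases (mem_weakOrder.1 hij).eq_or_lt with heq | hlt
    · have h' := eq_of_weakOrder_subset h heq
      simp [mem_weakOrder, heq, h']
    · by_contra hcon
      rw [mem_weakOrder, not_le] at hcon
      exact absurd (hε (mem_weakOrder.2 hcon.le)) (not_le.2 hlt)
  obtain ⟨ε, hsub, hpos⟩ := (hε.and self_mem_nhdsWithin).exists
  have hpos : 0 < ε := hpos
  obtain ⟨σ, hσ⟩ := exists_perm_maxCorrelation hA X
  have h1 := hp.1 (X - ε • X')
  rw [hσ _ hsub, inner_sub_right, inner_sub_left, hp.2, hσ X subset_rfl, inner_smul_right,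
    real_inner_smul_left] at h1
  rw [hσ X' h]
  have h2 : ε * ⟪X', permute A σ⟫_ℝ ≤ ε * ⟪p, X'⟫_ℝ := by linarith
  exact le_of_mul_le_mul_left h2 hpos

/-- The squared norm `|∇̄f(X)|²`: the discontinuous part of the potential energy. -/
def clusterEnergy (A X : EuclideanSpace ℝ (Fin N)) : ℝ :=
  ‖extendedGradient (maxCorrelation A) X‖ ^ 2

/-- The continuous part `|X|² - 2 f(X)` of the potential energy. -/
def smoothEnergy (A X : EuclideanSpace ℝ (Fin N)) : ℝ :=
  ‖X‖ ^ 2 - 2 * maxCorrelation A X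

theorem norm_sub_extendedGradient_sq (A X : EuclideanSpace ℝ (Fin N)) :
    ‖X - extendedGradient (maxCorrelation A) X‖ ^ 2 = smoothEnergy A X + clusterEnergy A X := by
  have h := (mem_subdifferential_iff.1 (isExtendedGradient_maxCorrelation A X).1).2
  rw [norm_sub_sq_real, smoothEnergy, clusterEnergy, real_inner_comm, h]

theorem clusterEnergy_nonneg (A X : EuclideanSpace ℝ (Fin N)) : 0 ≤ clusterEnergy A X :=
  sq_nonneg _

theorem clusterEnergy_le (A X : EuclideanSpace ℝ (Fin N)) : clusterEnergy A X ≤ ‖A‖ ^ 2 := by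
  obtain ⟨σ, hσ⟩ := exists_maxCorrelation_eq A X
  have hmem : permute A σ ∈ subdifferential (maxCorrelation A) X :=
    mem_subdifferential_iff.2 ⟨fun Y => by
      rw [real_inner_comm]; exact inner_permute_le A Y σ, by rw [real_inner_comm, hσ]⟩
  have := (isExtendedGradient_maxCorrelation A X).2 _ hmem
  rw [norm_permute] at this
  exact pow_le_pow_left₀ (norm_nonneg _) this 2

theorem extendedGradient_congr {A : EuclideanSpace ℝ (Fin N)} (hA : StrictMono fun i => A i)
    {X X' : EuclideanSpace ℝ (Fin N)} (h : weakOrder X = weakOrder X') :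
    extendedGradient (maxCorrelation A) X = extendedGradient (maxCorrelation A) X' := by
  refine (isExtendedGradient_maxCorrelation A X).unique ?_
  have h' := isExtendedGradient_maxCorrelation A X'
  exact ⟨subdifferential_subset hA h.superset h'.1,
    fun q hq => h'.2 q (subdifferential_subset hA h.subset hq)⟩

theorem clusterEnergy_congr {A : EuclideanSpace ℝ (Fin N)} (hA : StrictMono fun i => A i)
    {X X' : EuclideanSpace ℝ (Fin N)} (h : weakOrder X = weakOrder X') :
    clusterEnergy A X = clusterEnergy A X' := by
  rw [clusterEnergy, clusterEnergy, extendedGradient_congr hA h]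

theorem clusterEnergy_mono {A : EuclideanSpace ℝ (Fin N)} (hA : StrictMono fun i => A i)
    {X X' : EuclideanSpace ℝ (Fin N)} (h : weakOrder X ⊆ weakOrder X') :
    clusterEnergy A X' ≤ clusterEnergy A X :=
  pow_le_pow_left₀ (norm_nonneg _) ((isExtendedGradient_maxCorrelation A X').2 _
    (subdifferential_subset hA h (isExtendedGradient_maxCorrelation A X).1)) 2

theorem permute_swap_eq_self {X : EuclideanSpace ℝ (Fin N)} {i j : Fin N} (h : X i = X j) :
    permute X (Equiv.swap i j) = X := by
  ext k
  simp only [permute]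
  rcases eq_or_ne k i with rfl | hki
  · simp [h]
  rcases eq_or_ne k j with rfl | hkj
  · simp [h]
  · rw [Equiv.swap_apply_of_ne_of_ne hki hkj]

/-- By symmetry, the extended gradient is constant on clusters. -/
theorem extendedGradient_eq_of_eq (A : EuclideanSpace ℝ (Fin N)) {X : EuclideanSpace ℝ (Fin N)}
    {i j : Fin N} (h : X i = X j) :
    extendedGradient (maxCorrelation A) X i = extendedGradient (maxCorrelation A) X j := by
  set p := extendedGradient (maxCorrelation A) X
  have hp : IsExtendedGradient (maxCorrelation A) X p := isExtendedGradient_maxCorrelation A X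
  set τ := Equiv.swap i j
  have hττ : τ * τ = 1 := Equiv.swap_mul_self i j
  have hmem := mem_subdifferential_iff.1 hp.1
  have hperm : ∀ Y, ⟪permute p τ, Y⟫_ℝ = ⟪p, permute Y τ⟫_ℝ := by
    intro Y
    rw [← inner_permute_permute p (permute Y τ) τ, permute_permute, hττ, permute_one]
  have hq : IsExtendedGradient (maxCorrelation A) X (permute p τ) := by
    refine ⟨mem_subdifferential_iff.2 ⟨fun Y => ?_, ?_⟩, fun q hq => ?_⟩
    · rw [hperm, ← maxCorrelation_permute A Y τ]
      exact hmem.1 _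
    · rw [hperm, permute_swap_eq_self h, hmem.2]
    · rw [norm_permute]
      exact hp.2 q hq
  have := hp.unique hq
  calc p i = permute p τ i := by rw [← this]
    _ = p j := by simp [permute, τ]

/-- Subgradients of `f` separate the coordinates that `X` separates. -/
theorem ne_of_mem_subdifferential {A : EuclideanSpace ℝ (Fin N)} (hA : StrictMono fun i => A i)
    {X p : EuclideanSpace ℝ (Fin N)} (hp : p ∈ subdifferential (maxCorrelation A) X)
    {i j : Fin N} (h : X i ≠ X j) : p i ≠ p j := by
  intro hpij
  rw [mem_subdifferential_iff] at hp
  set τ := Equiv.swap i j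
  have h1 : ⟪p, permute X τ⟫_ℝ = maxCorrelation A X := by
    rw [← hp.2]
    conv_lhs => rw [← permute_swap_eq_self hpij]
    exact inner_permute_permute _ _ _
  have h2 := hp.1 (X + permute X τ)
  obtain ⟨σ, hσ⟩ := exists_maxCorrelation_eq A (X + permute X τ)
  rw [hσ, inner_add_right, inner_add_left, h1, hp.2] at h2
  have h3 := inner_permute_le A X σ
  have h4 := inner_permute_le A (permute X τ) σ
  rw [maxCorrelation_permute] at h4
  have h5 : ⟪X - permute X τ, permute A σ⟫_ℝ = 0 := by
    rw [inner_sub_left]; linarith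
  have hij : i ≠ j := fun e => h (by rw [e])
  have h6 : X - permute X τ =
      (X i - X j) • (EuclideanSpace.single i 1 - EuclideanSpace.single j 1) := by
    ext k
    rcases eq_or_ne k i with rfl | hki
    · simp [permute, τ, hij]
    rcases eq_or_ne k j with rfl | hkj
    · simp [permute, τ, hij.symm]
    · simp [permute, τ, Equiv.swap_apply_of_ne_of_ne hki hkj, hki, hkj]
  rw [h6, real_inner_smul_left, inner_sub_left, EuclideanSpace.inner_single_left,
    EuclideanSpace.inner_single_left] at h5
  simp only [map_one, one_mul, mul_eq_zero, sub_eq_zero] at h5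
  rcases h5 with h5 | h5
  · exact h h5
  · exact hij (σ.injective (hA.injective h5))

/-- Strict merging of clusters strictly decreases the cluster energy. -/
theorem weakOrder_eq_of_clusterEnergy_le {A : EuclideanSpace ℝ (Fin N)}
    (hA : StrictMono fun i => A i) {X X' : EuclideanSpace ℝ (Fin N)}
    (h : weakOrder X ⊆ weakOrder X') (hle : clusterEnergy A X ≤ clusterEnergy A X') :
    weakOrder X = weakOrder X' := by
  have hX := isExtendedGradient_maxCorrelation A X
  have hX' := isExtendedGradient_maxCorrelation A X'
  have hnorm := (sq_le_sq₀ (norm_nonneg _) (norm_nonneg _)).1 hle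
  have heq : extendedGradient (maxCorrelation A) X = extendedGradient (maxCorrelation A) X' :=
    IsExtendedGradient.unique (h := maxCorrelation A) (x := X')
      ⟨subdifferential_subset hA h hX.1, fun q hq => hnorm.trans (hX'.2 q hq)⟩ hX'
  refine h.antisymm ?_
  rintro ⟨i, j⟩ hij
  by_contra hcon
  rw [mem_weakOrder, not_le] at hcon
  have h1 : X' i = X' j := le_antisymm hij (h (mem_weakOrder.2 hcon.le))
  refine ne_of_mem_subdifferential hA hX.1 hcon.ne' ?_
  rw [heq]
  exact extendedGradient_eq_of_eq A h1

theorem finite_range_clusterEnergy {A : EuclideanSpace ℝ (Fin N)} (hA : StrictMono fun i => A i) :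
    (range (clusterEnergy A)).Finite := by
  have : ∀ X, clusterEnergy A (Function.invFun weakOrder (weakOrder X)) = clusterEnergy A X :=
    fun X => clusterEnergy_congr hA (Function.invFun_eq ⟨X, rfl⟩)
  refine (Set.finite_range fun s : Set (Fin N × Fin N) =>
    clusterEnergy A (Function.invFun weakOrder s)).subset ?_
  rintro _ ⟨X, rfl⟩
  exact ⟨weakOrder X, this X⟩

/-- The cluster energy takes finitely many values, hence distinct values differ by a definite
amount. -/
theorem exists_clusterEnergy_gap {A : EuclideanSpace ℝ (Fin N)} (hA : StrictMono fun i => A i) :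
    ∃ κ > 0, ∀ X Y, clusterEnergy A X < clusterEnergy A Y →
      clusterEnergy A X + κ ≤ clusterEnergy A Y := by
  have hfin := finite_range_clusterEnergy hA
  set D := (fun q : ℝ × ℝ => q.2 - q.1) ''
    ((range (clusterEnergy A) ×ˢ range (clusterEnergy A)) ∩ {q | q.1 < q.2}) with hD
  have hDfin : D.Finite := ((hfin.prod hfin).subset inter_subset_left).image _
  rcases D.eq_empty_or_nonempty with he | hne
  · refine ⟨1, one_pos, fun X Y h => ?_⟩
    have : clusterEnergy A Y - clusterEnergy A X ∈ D :=
      ⟨(clusterEnergy A X, clusterEnergy A Y), ⟨⟨⟨X, rfl⟩, ⟨Y, rfl⟩⟩, h⟩, rfl⟩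
    simp [he] at this
  · obtain ⟨κ, hκ, hmin⟩ := hDfin.exists_minimal hne
    refine ⟨κ, ?_, fun X Y h => ?_⟩
    · obtain ⟨q, ⟨-, hq⟩, rfl⟩ := hκ
      exact sub_pos.2 hq
    · have hm : clusterEnergy A Y - clusterEnergy A X ∈ D :=
        ⟨(clusterEnergy A X, clusterEnergy A Y), ⟨⟨⟨X, rfl⟩, ⟨Y, rfl⟩⟩, h⟩, rfl⟩
      rcases le_total κ (clusterEnergy A Y - clusterEnergy A X) with h' | h'
      · linarith
      · linarith [hmin hm h']

theorem lowerSemicontinuous_clusterEnergy {A : EuclideanSpace ℝ (Fin N)}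
    (hA : StrictMono fun i => A i) : LowerSemicontinuous (clusterEnergy A) := by
  intro X y hy
  filter_upwards [eventually_weakOrder_subset X] with Y hY
  exact hy.trans_le (clusterEnergy_mono hA hY)

theorem abs_smoothEnergy_sub_le (A : EuclideanSpace ℝ (Fin N)) {M : ℝ}
    {X Y : EuclideanSpace ℝ (Fin N)} (hX : ‖X‖ ≤ M) (hY : ‖Y‖ ≤ M) :
    |smoothEnergy A X - smoothEnergy A Y| ≤ 2 * (M + ‖A‖) * ‖X - Y‖ := by
  have h1 := abs_le.1 (abs_maxCorrelation_sub_le A X Y)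
  have h2 := abs_le.1 (abs_norm_sub_norm_le X Y)
  have h3 : |‖X‖ ^ 2 - ‖Y‖ ^ 2| ≤ 2 * M * ‖X - Y‖ := by
    rw [sq_sub_sq, abs_mul, abs_of_nonneg (by positivity)]
    exact mul_le_mul (by linarith) (abs_norm_sub_norm_le X Y) (abs_nonneg _)
      (by linarith [norm_nonneg X])
  have h4 := abs_le.1 h3
  simp only [smoothEnergy]
  rw [abs_le]
  constructor <;> nlinarith

theorem continuous_smoothEnergy (A : EuclideanSpace ℝ (Fin N)) :
    Continuous (smoothEnergy A) := by
  have : Continuous (maxCorrelation A) :=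
    (LipschitzWith.of_dist_le_mul (K := ‖A‖₊) fun X Y => by
      rw [Real.dist_eq, dist_eq_norm]; exact abs_maxCorrelation_sub_le A X Y).continuous
  unfold smoothEnergy
  fun_prop

/-! ### `H¹` curves and comparison with chords -/

theorem absolutelyContinuousOnInterval_lipschitz_comp {X Y : Type*} [PseudoMetricSpace X]
    [PseudoMetricSpace Y] {K : NNReal} {φ : X → Y} (hφ : LipschitzWith K φ) {f : ℝ → X} {a b : ℝ}
    (hf : AbsolutelyContinuousOnInterval f a b) :
    AbsolutelyContinuousOnInterval (fun t => φ (f t)) a b := by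
  refine squeeze_zero (fun E => Finset.sum_nonneg fun i _ => dist_nonneg) (fun E => ?_)
    (by simpa using Filter.Tendsto.const_mul (K : ℝ) hf)
  rw [Finset.mul_sum]
  exact Finset.sum_le_sum fun i _ => hφ.dist_le_mul _ _

/-- `Y` belongs to `H¹` of the interval between `c` and `d`. -/
structure IsH1Curve (Y : ℝ → EuclideanSpace ℝ (Fin N)) (c d : ℝ) : Prop where
  ac : AbsolutelyContinuousOnInterval Y c d
  sq : IntervalIntegrable (fun t => ‖deriv Y t‖ ^ 2) volume c d

theorem ae_differentiableAt_of_ac {Y : ℝ → EuclideanSpace ℝ (Fin N)} {c d : ℝ}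
    (h : AbsolutelyContinuousOnInterval Y c d) :
    ∀ᵐ x, x ∈ uIcc c d → DifferentiableAt ℝ Y x :=
  h.boundedVariationOn.ae_differentiableAt_of_mem_uIcc

theorem IsH1Curve.mono {Y : ℝ → EuclideanSpace ℝ (Fin N)} {a b c d : ℝ} (h : IsH1Curve Y a b)
    (hs : uIcc c d ⊆ uIcc a b) : IsH1Curve Y c d :=
  ⟨h.ac.mono hs, h.sq.mono_set hs⟩

theorem IsH1Curve.intervalIntegrable_deriv {Y : ℝ → EuclideanSpace ℝ (Fin N)} {c d : ℝ}
    (h : IsH1Curve Y c d) : IntervalIntegrable (deriv Y) volume c d := by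
  have h1 : IntervalIntegrable (fun t => 1 + ‖deriv Y t‖ ^ 2) volume c d :=
    intervalIntegrable_const.add h.sq
  refine h1.mono_fun (measurable_deriv Y).aestronglyMeasurable
    (Filter.Eventually.of_forall fun t => ?_)
  simp only [Real.norm_eq_abs]
  rw [abs_of_nonneg (by positivity)]
  nlinarith [sq_nonneg (‖deriv Y t‖ - 1)]

theorem isH1Curve_of_contDiff {Y : ℝ → EuclideanSpace ℝ (Fin N)} (h : ContDiff ℝ 1 Y) (c d : ℝ) :
    IsH1Curve Y c d :=
  ⟨h.contDiffOn.absolutelyContinuousOnInterval,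
    ((h.continuous_deriv le_rfl).norm.pow 2).intervalIntegrable _ _⟩

theorem IsH1Curve.smul_add_smul {Y W : ℝ → EuclideanSpace ℝ (Fin N)} {c d : ℝ}
    (hY : IsH1Curve Y c d) (hW : IsH1Curve W c d) (a b : ℝ) :
    IsH1Curve (fun t => a • Y t + b • W t) c d := by
  refine ⟨(hY.ac.const_smul a).fun_add (hW.ac.const_smul b), ?_⟩
  have h1 : IntervalIntegrable (fun t => 2 * a ^ 2 * ‖deriv Y t‖ ^ 2 + 2 * b ^ 2 * ‖deriv W t‖ ^ 2)
      volume c d := (hY.sq.const_mul _).add (hW.sq.const_mul _)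
  refine h1.mono_fun ((measurable_deriv _).norm.pow_const 2).aestronglyMeasurable ?_
  filter_upwards [ae_restrict_of_ae (ae_differentiableAt_of_ac hY.ac),
    ae_restrict_of_ae (ae_differentiableAt_of_ac hW.ac),
    ae_restrict_mem measurableSet_uIoc] with t h2 h3 ht
  have h2 := h2 (uIoc_subset_uIcc ht)
  have h3 := h3 (uIoc_subset_uIcc ht)
  have hder : HasDerivAt (fun t => a • Y t + b • W t) (a • deriv Y t + b • deriv W t) t :=
    (h2.hasDerivAt.const_smul a).add (h3.hasDerivAt.const_smul b)
  rw [hder.deriv, Real.norm_of_nonneg (by positivity), Real.norm_of_nonneg (by positivity)]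
  have h4 := norm_add_le (a • deriv Y t) (b • deriv W t)
  rw [norm_smul, norm_smul, Real.norm_eq_abs, Real.norm_eq_abs] at h4
  have h5 := pow_le_pow_left₀ (norm_nonneg _) h4 2
  have h6 := sq_abs a
  have h7 := sq_abs b
  nlinarith [sq_nonneg (|a| * ‖deriv Y t‖ - |b| * ‖deriv W t‖)]

theorem intervalIntegrable_const_inner {v : ℝ → EuclideanSpace ℝ (Fin N)} {c d : ℝ}
    (h : IntervalIntegrable v volume c d) (e : EuclideanSpace ℝ (Fin N)) :
    IntervalIntegrable (fun t => ⟪e, v t⟫_ℝ) volume c d :=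
  ⟨Integrable.const_inner (𝕜 := ℝ) e h.1, Integrable.const_inner (𝕜 := ℝ) e h.2⟩

theorem integral_inner_deriv {Y : ℝ → EuclideanSpace ℝ (Fin N)} {c d : ℝ}
    (h : AbsolutelyContinuousOnInterval Y c d) (e : EuclideanSpace ℝ (Fin N)) :
    ∫ t in c..d, ⟪e, deriv Y t⟫_ℝ = ⟪e, Y d - Y c⟫_ℝ := by
  have h1 : AbsolutelyContinuousOnInterval (fun t => ⟪e, Y t⟫_ℝ) c d :=
    absolutelyContinuousOnInterval_lipschitz_comp (innerSL ℝ e).lipschitz h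
  have h2 := h1.integral_deriv_eq_sub
  rw [inner_sub_right, ← h2]
  refine intervalIntegral.integral_congr_ae ?_
  filter_upwards [ae_differentiableAt_of_ac h] with t ht htm
  have h3 := (ht (uIoc_subset_uIcc htm)).hasDerivAt
  have h4 := (hasDerivAt_const t e).inner ℝ h3
  simpa using h4.deriv.symm

/-- The increment of `t ↦ Y_t - t w` is controlled by the `L²` norm of its derivative
(Cauchy–Schwarz). -/
theorem IsH1Curve.norm_sub_sq_le {Y : ℝ → EuclideanSpace ℝ (Fin N)} {c d : ℝ}
    (h : IsH1Curve Y c d) (w : EuclideanSpace ℝ (Fin N)) {u : ℝ} (hu : u ∈ Icc c d) :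
    IntervalIntegrable (fun t => ‖deriv Y t - w‖ ^ 2) volume c d ∧
    ‖Y u - (Y c + (u - c) • w)‖ ^ 2 ≤ (d - c) * ∫ t in c..d, ‖deriv Y t - w‖ ^ 2 := by
  have hcd : c ≤ d := hu.1.trans hu.2
  have hint := h.intervalIntegrable_deriv
  have hsq : IntervalIntegrable (fun t => ‖deriv Y t - w‖ ^ 2) volume c d := by
    have h1 : IntervalIntegrable (fun t => ‖deriv Y t‖ ^ 2 - 2 * ⟪w, deriv Y t⟫_ℝ + ‖w‖ ^ 2)
        volume c d := by
      refine (h.sq.sub (IntervalIntegrable.const_mul ?_ 2)).add intervalIntegrable_const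
      exact intervalIntegrable_const_inner hint w
    refine h1.congr fun t _ => ?_
    rw [norm_sub_sq_real, real_inner_comm]
  refine ⟨hsq, ?_⟩
  set e := Y u - (Y c + (u - c) • w) with he
  have hsub : uIcc c u ⊆ uIcc c d := by
    rw [uIcc_of_le hu.1, uIcc_of_le hcd]; exact Icc_subset_Icc_right hu.2
  have hint' := hint.mono_set hsub
  have h1 : ∫ t in c..u, ⟪e, deriv Y t - w⟫_ℝ = ‖e‖ ^ 2 := by
    simp only [inner_sub_right]
    rw [intervalIntegral.integral_sub (intervalIntegrable_const_inner hint' e)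
      intervalIntegrable_const, integral_inner_deriv (h.ac.mono hsub),
      intervalIntegral.integral_const, ← real_inner_self_eq_norm_sq, smul_eq_mul,
      ← inner_smul_right, ← inner_sub_right]
    congr 1
    rw [he]; abel
  have hsq' := hsq.mono_set hsub
  have h2 : ∫ t in c..u, (2 * (u - c) * ⟪e, deriv Y t - w⟫_ℝ) ≤
      ∫ t in c..u, ((u - c) ^ 2 * ‖deriv Y t - w‖ ^ 2 + ‖e‖ ^ 2) := by
    refine intervalIntegral.integral_mono_on hu.1 ?_
      ((hsq'.const_mul _).add intervalIntegrable_const) fun t _ => ?_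
    · have h3 := hint'.sub (intervalIntegrable_const (c := w))
      exact (intervalIntegrable_const_inner h3 e).const_mul _
    · have h4 : 0 ≤ ‖(u - c) • (deriv Y t - w) - e‖ ^ 2 := sq_nonneg _
      rw [norm_sub_sq_real, norm_smul, mul_pow, Real.norm_eq_abs, sq_abs, real_inner_smul_left,
        real_inner_comm] at h4
      linarith
  rw [intervalIntegral.integral_const_mul, h1, intervalIntegral.integral_add (hsq'.const_mul _)
    intervalIntegrable_const, intervalIntegral.integral_const_mul,
    intervalIntegral.integral_const, smul_eq_mul] at h2
  have h5 : ∫ t in c..u, ‖deriv Y t - w‖ ^ 2 ≤ ∫ t in c..d, ‖deriv Y t - w‖ ^ 2 :=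
    intervalIntegral.integral_mono_interval le_rfl hu.1 hu.2
      (Filter.Eventually.of_forall fun t => sq_nonneg _) hsq
  have h6 : 0 ≤ ∫ t in c..u, ‖deriv Y t - w‖ ^ 2 :=
    intervalIntegral.integral_nonneg hu.1 fun t _ => sq_nonneg _
  rcases hu.1.eq_or_lt with heq | hlt
  · have : e = 0 := by rw [he, heq]; simp
    rw [this]
    have : 0 ≤ (d - c) * ∫ t in c..d, ‖deriv Y t - w‖ ^ 2 :=
      mul_nonneg (by linarith) (h6.trans h5)
    simpa using this
  · have hpos : 0 < u - c := by linarith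
    have h7 : ‖e‖ ^ 2 ≤ (u - c) * ∫ t in c..u, ‖deriv Y t - w‖ ^ 2 := by
      have : (u - c) * ‖e‖ ^ 2 ≤ (u - c) * ((u - c) * ∫ t in c..u, ‖deriv Y t - w‖ ^ 2) := by
        linarith
      exact le_of_mul_le_mul_left this hpos
    refine h7.trans (mul_le_mul (by linarith [hu.2]) h5 h6 (by linarith))

/-- Along a continuous curve the cluster energy is integrable. -/
theorem intervalIntegrable_clusterEnergy {A : EuclideanSpace ℝ (Fin N)}
    (hA : StrictMono fun i => A i) {Y : ℝ → EuclideanSpace ℝ (Fin N)} {c d : ℝ}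
    (hY : ContinuousOn Y (uIcc c d)) :
    IntervalIntegrable (fun t => clusterEnergy A (Y t)) volume c d := by
  have h1 : AEMeasurable Y (volume.restrict (uIoc c d)) :=
    (hY.mono uIoc_subset_uIcc).aemeasurable measurableSet_uIoc
  have h2 := (lowerSemicontinuous_clusterEnergy hA).measurable.comp_aemeasurable h1
  refine (intervalIntegrable_const (c := ‖A‖ ^ 2)).mono_fun h2.aestronglyMeasurable
    (Filter.Eventually.of_forall fun t => ?_)
  simp only
  rw [Real.norm_of_nonneg (clusterEnergy_nonneg _ _), Real.norm_of_nonneg (by positivity)]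
  exact clusterEnergy_le _ _

theorem intervalIntegrable_smoothEnergy (A : EuclideanSpace ℝ (Fin N))
    {Y : ℝ → EuclideanSpace ℝ (Fin N)} {c d : ℝ} (hY : ContinuousOn Y (uIcc c d)) :
    IntervalIntegrable (fun t => smoothEnergy A (Y t)) volume c d :=
  ((continuous_smoothEnergy A).comp_continuousOn hY).intervalIntegrable

/-- The integrand of the action. -/
def lagrangian (A : EuclideanSpace ℝ (Fin N)) (Y : ℝ → EuclideanSpace ℝ (Fin N)) (t : ℝ) : ℝ :=
  ‖deriv Y t‖ ^ 2 + (smoothEnergy A (Y t) + clusterEnergy A (Y t))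

theorem IsH1Curve.intervalIntegrable_lagrangian {A : EuclideanSpace ℝ (Fin N)}
    (hA : StrictMono fun i => A i) {Y : ℝ → EuclideanSpace ℝ (Fin N)} {c d : ℝ}
    (hY : IsH1Curve Y c d) : IntervalIntegrable (lagrangian A Y) volume c d :=
  hY.sq.add ((intervalIntegrable_smoothEnergy A hY.ac.continuousOn).add
    (intervalIntegrable_clusterEnergy hA hY.ac.continuousOn))

/-- `Z` is an `H¹` curve on `[0, T]` whose action on each subinterval is minimal among the `H¹`
curves with the same endpoints there. -/
structure IsLocalMinimizer (A : EuclideanSpace ℝ (Fin N)) (T : ℝ)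
    (Z : ℝ → EuclideanSpace ℝ (Fin N)) : Prop where
  curve : IsH1Curve Z 0 T
  le : ∀ c d, 0 ≤ c → c ≤ d → d ≤ T → ∀ Y, IsH1Curve Y c d → Y c = Z c → Y d = Z d →
    ∫ t in c..d, lagrangian A Z t ≤ ∫ t in c..d, lagrangian A Y t

section Comparison

variable {A : EuclideanSpace ℝ (Fin N)} {T : ℝ} {Z : ℝ → EuclideanSpace ℝ (Fin N)}

theorem IsLocalMinimizer.isH1Curve (hZ : IsLocalMinimizer A T Z) {c d : ℝ} (hc : 0 ≤ c)
    (hcd : c ≤ d) (hd : d ≤ T) : IsH1Curve Z c d :=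
  hZ.curve.mono (by
    rw [uIcc_of_le hcd, uIcc_of_le (hc.trans (hcd.trans hd))]; exact Icc_subset_Icc hc hd)

theorem IsLocalMinimizer.continuousOn (hZ : IsLocalMinimizer A T Z) (hT : 0 ≤ T) :
    ContinuousOn Z (Icc 0 T) := by
  have := hZ.curve.ac.continuousOn
  rwa [uIcc_of_le hT] at this

/-- The comparison of the action of a minimizer with that of a uniformly close competitor: only
the kinetic and the cluster energies matter, up to a Lipschitz error. -/
theorem IsLocalMinimizer.compare (hA : StrictMono fun i => A i) (hZ : IsLocalMinimizer A T Z)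
    {c d : ℝ} (hc : 0 ≤ c) (hcd : c ≤ d) (hd : d ≤ T) {Y : ℝ → EuclideanSpace ℝ (Fin N)}
    (hY : IsH1Curve Y c d) (hYc : Y c = Z c) (hYd : Y d = Z d) {M B : ℝ}
    (hZM : ∀ t ∈ Icc c d, ‖Z t‖ ≤ M) (hYM : ∀ t ∈ Icc c d, ‖Y t‖ ≤ M)
    (hB : ∀ t ∈ Icc c d, ‖Z t - Y t‖ ≤ B) :
    (∫ t in c..d, ‖deriv Z t‖ ^ 2) + ∫ t in c..d, clusterEnergy A (Z t) ≤
      (∫ t in c..d, ‖deriv Y t‖ ^ 2) + (∫ t in c..d, clusterEnergy A (Y t)) +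
        (d - c) * (2 * (M + ‖A‖) * B) := by
  have hZ1 := hZ.isH1Curve hc hcd hd
  have h1 := hZ.le c d hc hcd hd Y hY hYc hYd
  have expand : ∀ {W : ℝ → EuclideanSpace ℝ (Fin N)}, IsH1Curve W c d →
      ∫ t in c..d, lagrangian A W t = (∫ t in c..d, ‖deriv W t‖ ^ 2) +
        ((∫ t in c..d, smoothEnergy A (W t)) + ∫ t in c..d, clusterEnergy A (W t)) := by
    intro W hW
    have hs := intervalIntegrable_smoothEnergy A hW.ac.continuousOn
    have hg := intervalIntegrable_clusterEnergy hA hW.ac.continuousOn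
    unfold lagrangian
    rw [intervalIntegral.integral_add hW.sq (hs.add hg), intervalIntegral.integral_add hs hg]
  rw [expand hZ1, expand hY] at h1
  have hM0 : 0 ≤ M := (norm_nonneg _).trans (hZM c (left_mem_Icc.2 hcd))
  have h2 : (∫ t in c..d, smoothEnergy A (Y t)) ≤
      ∫ t in c..d, (smoothEnergy A (Z t) + 2 * (M + ‖A‖) * B) := by
    refine intervalIntegral.integral_mono_on hcd
      (intervalIntegrable_smoothEnergy A hY.ac.continuousOn)
      ((intervalIntegrable_smoothEnergy A hZ1.ac.continuousOn).add intervalIntegrable_const)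
      fun t ht => ?_
    have h3 := (abs_le.1 (abs_smoothEnergy_sub_le A (hZM t ht) (hYM t ht))).1
    have h4 : 2 * (M + ‖A‖) * ‖Z t - Y t‖ ≤ 2 * (M + ‖A‖) * B :=
      mul_le_mul_of_nonneg_left (hB t ht) (by positivity)
    linarith
  rw [intervalIntegral.integral_add (intervalIntegrable_smoothEnergy A hZ1.ac.continuousOn)
    intervalIntegrable_const, intervalIntegral.integral_const, smul_eq_mul] at h2
  linarith

/-- The slope of the chord of `Z` over `[c, d]`. -/
def chordSlope (Z : ℝ → EuclideanSpace ℝ (Fin N)) (c d : ℝ) : EuclideanSpace ℝ (Fin N) :=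
  (d - c)⁻¹ • (Z d - Z c)

theorem smul_chordSlope {c d : ℝ} (h : c < d) : (d - c) • chordSlope Z c d = Z d - Z c := by
  rw [chordSlope, smul_smul, mul_inv_cancel₀ (by linarith), one_smul]

theorem chord_eq_combo {c d : ℝ} (h : c < d) (u : ℝ) :
    Z c + (u - c) • chordSlope Z c d =
      ((d - u) / (d - c)) • Z c + ((u - c) / (d - c)) • Z d := by
  have h1 : (d - u) / (d - c) = 1 - (u - c) / (d - c) := by
    have : d - c ≠ 0 := by linarith
    field_simp; ring
  rw [h1, chordSlope, smul_smul, ← div_eq_mul_inv, smul_sub, sub_smul, one_smul]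
  abel

theorem norm_chord_le {c d M : ℝ} (h : c < d) (hc : ‖Z c‖ ≤ M) (hd : ‖Z d‖ ≤ M) {u : ℝ}
    (hu : u ∈ Icc c d) : ‖Z c + (u - c) • chordSlope Z c d‖ ≤ M := by
  have h0 : 0 < d - c := by linarith
  have := (convex_closedBall (0 : EuclideanSpace ℝ (Fin N)) M) (mem_closedBall_zero_iff.2 hc)
    (mem_closedBall_zero_iff.2 hd) (a := (d - u) / (d - c)) (b := (u - c) / (d - c))
    (div_nonneg (by linarith [hu.2]) h0.le) (div_nonneg (by linarith [hu.1]) h0.le)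
    (by field_simp; ring)
  rw [chord_eq_combo h]
  exact mem_closedBall_zero_iff.1 this

theorem weakOrder_chord {c d : ℝ} (h : c < d) (hsub : weakOrder (Z d) ⊆ weakOrder (Z c)) {u : ℝ}
    (hu : u ∈ Ioc c d) : weakOrder (Z c + (u - c) • chordSlope Z c d) = weakOrder (Z d) := by
  rw [chord_eq_combo h]
  have h0 : 0 < d - c := by linarith
  exact weakOrder_combo hsub (div_nonneg (by linarith [hu.2]) h0.le)
    (div_pos (by linarith [hu.1]) h0)

theorem contDiff_affine (X w : EuclideanSpace ℝ (Fin N)) (c : ℝ) :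
    ContDiff ℝ 1 fun u : ℝ => X + (u - c) • w := by fun_prop

theorem deriv_affine (X w : EuclideanSpace ℝ (Fin N)) (c u : ℝ) :
    deriv (fun u : ℝ => X + (u - c) • w) u = w := by
  have := (((hasDerivAt_id u).sub_const c).smul_const w).const_add X
  simpa using this.deriv

/-- The squared `L²` distance of `Ż` to its mean over `[c, d]`. -/
theorem integral_norm_sub_chordSlope_sq {c d : ℝ} (hcd : c < d) (hZ : IsH1Curve Z c d) :
    ∫ t in c..d, ‖deriv Z t - chordSlope Z c d‖ ^ 2 =
      (∫ t in c..d, ‖deriv Z t‖ ^ 2) - (d - c) * ‖chordSlope Z c d‖ ^ 2 := by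
  set w := chordSlope Z c d with hw
  have hint := (intervalIntegrable_const_inner hZ.intervalIntegrable_deriv w).const_mul 2
  have : ∀ t, ‖deriv Z t - w‖ ^ 2 = ‖deriv Z t‖ ^ 2 - 2 * ⟪w, deriv Z t⟫_ℝ + ‖w‖ ^ 2 :=
    fun t => by rw [norm_sub_sq_real, real_inner_comm]
  simp only [this]
  rw [intervalIntegral.integral_add (hZ.sq.sub hint) intervalIntegrable_const,
    intervalIntegral.integral_sub hZ.sq hint, intervalIntegral.integral_const_mul,
    integral_inner_deriv hZ.ac, ← smul_chordSlope hcd, ← hw, inner_smul_right,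
    real_inner_self_eq_norm_sq, intervalIntegral.integral_const, smul_eq_mul]
  ring

/-- Comparison with the chord over `[c, d]`. -/
theorem IsLocalMinimizer.compare_chord (hA : StrictMono fun i => A i) (hZ : IsLocalMinimizer A T Z)
    {c d : ℝ} (hc : 0 ≤ c) (hcd : c < d) (hd : d ≤ T) {M B : ℝ}
    (hZM : ∀ t ∈ Icc c d, ‖Z t‖ ≤ M)
    (hB : ∀ t ∈ Icc c d, ‖Z t - (Z c + (t - c) • chordSlope Z c d)‖ ≤ B)
    (hsub : weakOrder (Z d) ⊆ weakOrder (Z c)) :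
    (∫ t in c..d, ‖deriv Z t - chordSlope Z c d‖ ^ 2) + ∫ t in c..d, clusterEnergy A (Z t) ≤
      (d - c) * clusterEnergy A (Z d) + (d - c) * (2 * (M + ‖A‖) * B) := by
  set w := chordSlope Z c d with hw
  have hY : IsH1Curve (fun u : ℝ => Z c + (u - c) • w) c d :=
    isH1Curve_of_contDiff (contDiff_affine _ _ _) c d
  have h1 := hZ.compare hA hc hcd.le hd hY (by simp) (by rw [hw, smul_chordSlope hcd]; abel) hZM
    (fun t ht => norm_chord_le hcd (hZM c (left_mem_Icc.2 hcd.le)) (hZM d (right_mem_Icc.2 hcd.le))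
      ht) hB
  have h2 : ∫ t in c..d, clusterEnergy A (Z c + (t - c) • w) =
      (d - c) * clusterEnergy A (Z d) := by
    rw [intervalIntegral.integral_congr_ae (g := fun _ => clusterEnergy A (Z d))]
    · simp
    · refine Filter.Eventually.of_forall fun t ht => ?_
      rw [uIoc_of_le hcd.le] at ht
      exact clusterEnergy_congr hA (weakOrder_chord hcd hsub ht)
  simp only [deriv_affine] at h1
  rw [h2, intervalIntegral.integral_const, smul_eq_mul] at h1
  have h3 := integral_norm_sub_chordSlope_sq hcd (hZ.isH1Curve hc hcd.le hd)
  rw [← hw] at h3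
  rw [h3]
  linarith

/-- If moreover the cluster energy of `Z` on `[c, d]` is at least that of the endpoint `Z_d`, then
`Z` is quadratically close to its chord, and the excess of cluster energy is of third order. -/
theorem IsLocalMinimizer.chord_estimate (hA : StrictMono fun i => A i)
    (hZ : IsLocalMinimizer A T Z)
    {c d : ℝ} (hc : 0 ≤ c) (hcd : c < d) (hd : d ≤ T) {M : ℝ}
    (hZM : ∀ t ∈ Icc c d, ‖Z t‖ ≤ M) (hsub : weakOrder (Z d) ⊆ weakOrder (Z c))
    (hmin : ∀ t ∈ Ioo c d, clusterEnergy A (Z d) ≤ clusterEnergy A (Z t)) :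
    (∀ t ∈ Icc c d, ‖Z t - (Z c + (t - c) • chordSlope Z c d)‖ ≤
      2 * (M + ‖A‖) * (d - c) ^ 2) ∧
    ∫ t in c..d, (clusterEnergy A (Z t) - clusterEnergy A (Z d)) ≤
      (2 * (M + ‖A‖)) ^ 2 * (d - c) ^ 3 := by
  set w := chordSlope Z c d with hw
  set K := 2 * (M + ‖A‖) with hK
  have hK0 : 0 ≤ K := by
    have : 0 ≤ M := (norm_nonneg _).trans (hZM c (left_mem_Icc.2 hcd.le))
    positivity
  have hZ1 := hZ.isH1Curve hc hcd.le hd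
  have hδ : 0 < d - c := by linarith
  set J := ∫ t in c..d, ‖deriv Z t - w‖ ^ 2 with hJ
  have hJ0 : 0 ≤ J := intervalIntegral.integral_nonneg hcd.le fun t _ => sq_nonneg _
  have hB : ∀ t ∈ Icc c d, ‖Z t - (Z c + (t - c) • w)‖ ≤ Real.sqrt ((d - c) * J) := fun t ht =>
    Real.le_sqrt_of_sq_le (hZ1.norm_sub_sq_le w ht).2
  have hg := intervalIntegrable_clusterEnergy hA hZ1.ac.continuousOn
  have h1 := hZ.compare_chord hA hc hcd hd hZM hB hsub
  have h2 : ∫ t in c..d, (clusterEnergy A (Z t) - clusterEnergy A (Z d)) =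
      (∫ t in c..d, clusterEnergy A (Z t)) - (d - c) * clusterEnergy A (Z d) := by
    rw [intervalIntegral.integral_sub hg intervalIntegrable_const, intervalIntegral.integral_const,
      smul_eq_mul]
  have h3 : 0 ≤ ∫ t in c..d, (clusterEnergy A (Z t) - clusterEnergy A (Z d)) := by
    rw [intervalIntegral.integral_of_le hcd.le, integral_Ioc_eq_integral_Ioo]
    exact setIntegral_nonneg measurableSet_Ioo fun t ht => sub_nonneg.2 (hmin t ht)
  set S := Real.sqrt ((d - c) * J) with hS
  have hS0 : 0 ≤ S := Real.sqrt_nonneg _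
  have hS2 : S ^ 2 = (d - c) * J := Real.sq_sqrt (by positivity)
  have h4 : J + ∫ t in c..d, (clusterEnergy A (Z t) - clusterEnergy A (Z d)) ≤
      (d - c) * (K * S) := by
    rw [h2]; linarith
  have h5 : S ≤ K * (d - c) ^ 2 := by
    rcases hS0.eq_or_lt with h | h
    · rw [← h]; positivity
    · have : S * S ≤ S * (K * (d - c) ^ 2) := by nlinarith
      exact le_of_mul_le_mul_left this h
  refine ⟨fun t ht => (hB t ht).trans h5, ?_⟩
  have : (d - c) * (K * S) ≤ (d - c) * (K * (K * (d - c) ^ 2)) := by gcongr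
  nlinarith

end Comparison

/-! ### Existence of a right velocity -/

/-- A function with finite range has a smallest value among those it takes frequently. -/
theorem exists_frequently_eq_eventually_le {α : Type*} {l : Filter α} [l.NeBot] {φ : α → ℝ}
    (hφ : (range φ).Finite) : ∃ γ, (∃ᶠ s in l, φ s = γ) ∧ ∀ᶠ s in l, γ ≤ φ s := by
  set R := {v ∈ range φ | ∃ᶠ s in l, φ s = v} with hR
  have hRfin : R.Finite := hφ.subset (sep_subset _ _)
  have hRne : R.Nonempty := by
    by_contra hne
    rw [not_nonempty_iff_eq_empty] at hne
    have : ∀ᶠ s in l, ∀ v ∈ range φ, φ s ≠ v := by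
      refine (Filter.eventually_all_finite hφ).2 fun v hv => ?_
      by_contra hcon
      have : v ∈ R := ⟨hv, by rw [Filter.Frequently]; exact hcon⟩
      simp [hne] at this
    obtain ⟨s, hs⟩ := this.exists
    exact hs _ ⟨s, rfl⟩ rfl
  obtain ⟨γ, hγ, hmin⟩ := hRfin.exists_minimal hRne
  refine ⟨γ, hγ.2, ?_⟩
  have : ∀ᶠ s in l, ∀ v ∈ range φ, v < γ → φ s ≠ v := by
    refine (Filter.eventually_all_finite hφ).2 fun v hv => ?_
    by_cases hlt : v < γ
    · by_contra hcon
      refine absurd (hmin (y := v) ⟨hv, fun h => hcon ?_⟩ hlt.le) (not_le.2 hlt)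
      filter_upwards [h] with s hs _ using hs
    · exact Filter.Eventually.of_forall fun s h => absurd h hlt
  filter_upwards [this] with s hs
  by_contra hlt
  exact hs _ ⟨s, rfl⟩ (not_le.1 hlt) rfl

section RightGerm

variable {A : EuclideanSpace ℝ (Fin N)} {T : ℝ} {Z : ℝ → EuclideanSpace ℝ (Fin N)}

theorem tendsto_nhdsGT_of_continuousOn (hZ : ContinuousOn Z (Icc 0 T)) {t : ℝ}
    (ht : t ∈ Ico 0 T) : Filter.Tendsto Z (nhdsWithin t (Ioi t)) (nhds (Z t)) := by
  refine (hZ t (Ico_subset_Icc_self ht)).mono_left ?_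
  rw [← nhdsWithin_Ioo_eq_nhdsGT ht.2]
  exact nhdsWithin_mono _ ((Ioo_subset_Ioo_left ht.1).trans Ioo_subset_Icc_self)

/-- If the cluster energy on `(t, s]` is minimal at `s`, it takes the same value somewhere in the
second quarter of `[t, s]`: otherwise its excess would be at least `κ (s - t) / 4`, which is not of
third order. -/
theorem IsLocalMinimizer.exists_good_time (hA : StrictMono fun i => A i)
    (hZ : IsLocalMinimizer A T Z) {κ : ℝ}
    (hgap : ∀ X Y, clusterEnergy A X < clusterEnergy A Y →
      clusterEnergy A X + κ ≤ clusterEnergy A Y)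
    {t s M : ℝ} (ht : 0 ≤ t) (hts : t < s) (hs : s ≤ T) (hM : ∀ u ∈ Icc t s, ‖Z u‖ ≤ M)
    (hsub : weakOrder (Z s) ⊆ weakOrder (Z t))
    (hmin : ∀ u ∈ Ioo t s, clusterEnergy A (Z s) ≤ clusterEnergy A (Z u))
    (hsmall : 4 * (2 * (M + ‖A‖)) ^ 2 * (s - t) ^ 2 < κ) :
    ∃ r ∈ Icc (t + (s - t) / 4) (t + (s - t) / 2),
      clusterEnergy A (Z r) = clusterEnergy A (Z s) := by
  by_contra hcon
  push Not at hcon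
  have hτ : 0 < s - t := by linarith
  have hle : t + (s - t) / 4 ≤ t + (s - t) / 2 := by linarith
  have h1 := (hZ.chord_estimate hA ht hts hs hM hsub hmin).2
  have hZ1 := hZ.isH1Curve ht hts.le hs
  have hg : IntervalIntegrable (fun u => clusterEnergy A (Z u) - clusterEnergy A (Z s))
      volume t s :=
    (intervalIntegrable_clusterEnergy hA hZ1.ac.continuousOn).sub intervalIntegrable_const
  have h2 : ∫ u in (t + (s - t) / 4)..(t + (s - t) / 2),
      (clusterEnergy A (Z u) - clusterEnergy A (Z s)) ≤
      ∫ u in t..s, (clusterEnergy A (Z u) - clusterEnergy A (Z s)) := by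
    refine intervalIntegral.integral_mono_interval (by linarith) hle (by linarith) ?_ hg
    rw [← restrict_Ioo_eq_restrict_Ioc]
    filter_upwards [ae_restrict_mem measurableSet_Ioo] with u hu
    exact sub_nonneg.2 (hmin u hu)
  have h3 : ∫ u in (t + (s - t) / 4)..(t + (s - t) / 2), κ ≤
      ∫ u in (t + (s - t) / 4)..(t + (s - t) / 2),
        (clusterEnergy A (Z u) - clusterEnergy A (Z s)) := by
    refine intervalIntegral.integral_mono_on hle intervalIntegrable_const
      (hg.mono_set ?_) fun u hu => ?_
    · rw [uIcc_of_le hle, uIcc_of_le hts.le]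
      exact Icc_subset_Icc (by linarith) (by linarith)
    · have := hmin u ⟨by linarith [hu.1], by linarith [hu.2]⟩
      linarith [hgap _ _ (this.lt_of_ne (hcon u hu).symm)]
  rw [intervalIntegral.integral_const, smul_eq_mul] at h3
  have h4 : (s - t) * κ ≤ (s - t) * (4 * (2 * (M + ‖A‖)) ^ 2 * (s - t) ^ 2) := by nlinarith
  exact absurd (le_of_mul_le_mul_left h4 hτ) (not_le.2 hsmall)

/-- A minimizer has a right derivative `w` at every time, with a quadratic remainder. It is the
limit of the slopes of the chords over a sequence of good times decaying geometrically. -/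
theorem IsLocalMinimizer.exists_right_velocity (hA : StrictMono fun i => A i)
    (hZ : IsLocalMinimizer A T Z) {t M γ s₀ : ℝ} (ht : 0 ≤ t) (hts : t < s₀) (hs : s₀ ≤ T)
    (hM : ∀ u ∈ Icc t s₀, ‖Z u‖ ≤ M) {κ : ℝ}
    (hgap : ∀ X Y, clusterEnergy A X < clusterEnergy A Y →
      clusterEnergy A X + κ ≤ clusterEnergy A Y)
    (hsub : ∀ u ∈ Ioc t s₀, weakOrder (Z u) ⊆ weakOrder (Z t))
    (hmin : ∀ u ∈ Ioc t s₀, γ ≤ clusterEnergy A (Z u))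
    (hs₀ : clusterEnergy A (Z s₀) = γ)
    (hsmall : 4 * (2 * (M + ‖A‖)) ^ 2 * (s₀ - t) ^ 2 < κ) :
    ∃ w, ∃ C ≥ 0, ∀ u ∈ Icc t s₀, ‖Z u - (Z t + (u - t) • w)‖ ≤ C * (u - t) ^ 2 := by
  set K := 2 * (M + ‖A‖) with hK
  have hK0 : 0 ≤ K := by
    have : 0 ≤ M := (norm_nonneg _).trans (hM t (left_mem_Icc.2 hts.le))
    positivity
  have est : ∀ s ∈ Ioc t s₀, clusterEnergy A (Z s) = γ → ∀ u ∈ Icc t s,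
      ‖Z u - (Z t + (u - t) • chordSlope Z t s)‖ ≤ K * (s - t) ^ 2 := fun s hs' hsγ =>
    (hZ.chord_estimate hA ht hs'.1 (hs'.2.trans hs)
      (fun u hu => hM u ⟨hu.1, hu.2.trans hs'.2⟩) (hsub s hs')
      fun u hu => hsγ.trans_le (hmin u ⟨hu.1, hu.2.le.trans hs'.2⟩)).1
  have step : ∀ x : {s // s ∈ Ioc t s₀ ∧ clusterEnergy A (Z s) = γ},
      ∃ y : {s // s ∈ Ioc t s₀ ∧ clusterEnergy A (Z s) = γ},
        (y : ℝ) ∈ Icc (t + (x - t) / 4) (t + (x - t) / 2) := by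
    rintro ⟨s, hs', hsγ⟩
    have h0 : 0 < s - t := by linarith [hs'.1]
    have h1 : (s - t) ^ 2 ≤ (s₀ - t) ^ 2 := pow_le_pow_left₀ h0.le (by linarith [hs'.2]) 2
    obtain ⟨r, hr, hrγ⟩ := hZ.exists_good_time hA hgap ht hs'.1 (hs'.2.trans hs)
      (fun u hu => hM u ⟨hu.1, hu.2.trans hs'.2⟩) (hsub s hs')
      (fun u hu => hsγ.trans_le (hmin u ⟨hu.1, hu.2.le.trans hs'.2⟩))
      ((mul_le_mul_of_nonneg_left h1 (by positivity)).trans_lt hsmall)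
    exact ⟨⟨r, ⟨by linarith [hr.1], by linarith [hr.2, hs'.2]⟩, hrγ.trans hsγ⟩, hr⟩
  choose F hF using step
  set σ : ℕ → {s // s ∈ Ioc t s₀ ∧ clusterEnergy A (Z s) = γ} :=
    fun n => F^[n] ⟨s₀, ⟨hts, le_rfl⟩, hs₀⟩ with hσ
  have hσ0 : (σ 0 : ℝ) = s₀ := rfl
  have hσstep : ∀ n, (σ (n + 1) : ℝ) ∈ Icc (t + (σ n - t) / 4) (t + (σ n - t) / 2) := by
    intro n
    have : σ (n + 1) = F (σ n) := by simp only [hσ, Function.iterate_succ_apply']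
    rw [this]; exact hF _
  have hpos : ∀ n, 0 < (σ n : ℝ) - t := fun n => by linarith [(σ n).2.1.1]
  set W : ℕ → EuclideanSpace ℝ (Fin N) := fun n => chordSlope Z t (σ n) with hW
  have hest : ∀ n, ∀ u ∈ Icc t (σ n : ℝ), ‖Z u - (Z t + (u - t) • W n)‖ ≤ K * ((σ n : ℝ) - t) ^ 2 :=
    fun n => est _ (σ n).2.1 (σ n).2.2
  -- consecutive slopes differ by at most the telescoping quantity `8 K (σ n - σ (n + 1))`
  have hWstep : ∀ n, ‖W (n + 1) - W n‖ ≤ 8 * K * ((σ n : ℝ) - σ (n + 1)) := by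
    intro n
    have h1 := hσstep n
    have h2 := hpos n
    have h3 := hpos (n + 1)
    have h4 := hest n (σ (n + 1)) ⟨by linarith, by linarith [h1.2]⟩
    have h5 : Z (σ (n + 1)) - (Z t + ((σ (n + 1) : ℝ) - t) • W n) =
        ((σ (n + 1) : ℝ) - t) • (W (n + 1) - W n) := by
      rw [smul_sub, hW]
      simp only
      rw [smul_chordSlope (σ (n + 1)).2.1.1]
      abel
    rw [h5, norm_smul, Real.norm_of_nonneg h3.le] at h4
    have h6 : ((σ n : ℝ) - t) * ‖W (n + 1) - W n‖ ≤
        ((σ n : ℝ) - t) * (8 * K * ((σ n : ℝ) - σ (n + 1))) := by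
      have h7 : ((σ n : ℝ) - t) / 4 * ‖W (n + 1) - W n‖ ≤
          ((σ (n + 1) : ℝ) - t) * ‖W (n + 1) - W n‖ :=
        mul_le_mul_of_nonneg_right (by linarith [h1.1]) (norm_nonneg _)
      have h8 : K * ((σ n : ℝ) - t) * (((σ n : ℝ) - t) / 2) ≤
          K * ((σ n : ℝ) - t) * ((σ n : ℝ) - σ (n + 1)) :=
        mul_le_mul_of_nonneg_left (by linarith [h1.2]) (by positivity)
      nlinarith
    exact le_of_mul_le_mul_left h6 h2
  have hWle : ∀ n m, n ≤ m → ‖W m - W n‖ ≤ 8 * K * ((σ n : ℝ) - σ m) := by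
    intro n m hnm
    induction m, hnm using Nat.le_induction with
    | base => simp
    | succ m _ ih =>
      have h1 := norm_sub_le_norm_sub_add_norm_sub (W (m + 1)) (W m) (W n)
      linarith [hWstep m]
  have hσle : ∀ n, (σ n : ℝ) - t ≤ (s₀ - t) * (1 / 2) ^ n := by
    intro n
    induction n with
    | zero => simp [hσ0]
    | succ n ih =>
      have := (hσstep n).2
      rw [pow_succ]
      linarith
  have hσlim : Filter.Tendsto (fun n => 8 * K * ((s₀ - t) * (1 / 2 : ℝ) ^ n)) Filter.atTop
      (nhds 0) := by
    have := (tendsto_pow_atTop_nhds_zero_of_lt_one (r := (1 / 2 : ℝ)) (by norm_num)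
      (by norm_num)).const_mul (8 * K * (s₀ - t))
    simpa [mul_assoc] using this
  have hWle' : ∀ n m, n ≤ m → ‖W m - W n‖ ≤ 8 * K * ((σ n : ℝ) - t) := fun n m hnm =>
    (hWle n m hnm).trans (mul_le_mul_of_nonneg_left (by linarith [hpos m]) (by positivity))
  have hcau : CauchySeq W := by
    refine cauchySeq_of_le_tendsto_0' _ (fun n m hnm => ?_) hσlim
    rw [dist_comm, dist_eq_norm]
    exact (hWle' n m hnm).trans (mul_le_mul_of_nonneg_left (hσle n) (by positivity))
  obtain ⟨w, hw⟩ := cauchySeq_tendsto_of_complete hcau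
  have hWw : ∀ n, ‖w - W n‖ ≤ 8 * K * ((σ n : ℝ) - t) := fun n =>
    le_of_tendsto ((hw.sub_const (W n)).norm)
      (Filter.eventually_atTop.2 ⟨n, fun m hm => hWle' n m hm⟩)
  refine ⟨w, 48 * K, by positivity, fun u hu => ?_⟩
  rcases hu.1.eq_or_lt with rfl | htu
  · simp
  have hex : ∃ n, (σ n : ℝ) < u := by
    have h1 : Filter.Tendsto (fun n => (s₀ - t) * (1 / 2 : ℝ) ^ n) Filter.atTop (nhds 0) := by
      simpa using (tendsto_pow_atTop_nhds_zero_of_lt_one (r := (1 / 2 : ℝ)) (by norm_num)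
        (by norm_num)).const_mul (s₀ - t)
    obtain ⟨n, hn⟩ := (h1.eventually (gt_mem_nhds (sub_pos.2 htu))).exists
    exact ⟨n, by linarith [hσle n]⟩
  classical
  have hn := Nat.find_spec hex
  have hn' := fun m => Nat.find_min hex (m := m)
  obtain ⟨k, hk⟩ : ∃ k, Nat.find hex = k + 1 := by
    refine Nat.exists_eq_succ_of_ne_zero fun h0 => ?_
    rw [h0, hσ0] at hn
    linarith [hu.2]
  rw [hk] at hn hn'
  have hku : u ≤ σ k := not_lt.1 (hn' k (Nat.lt_succ_self k))
  have h1 := hest k u ⟨hu.1, hku⟩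
  have h2 := (hσstep k).1
  have h3 := hWw k
  have h4 : Z u - (Z t + (u - t) • w) =
      (Z u - (Z t + (u - t) • W k)) - (u - t) • (w - W k) := by
    rw [smul_sub]; abel
  have hu0 : 0 < u - t := by linarith
  rw [h4]
  refine (norm_sub_le _ _).trans ?_
  rw [norm_smul, Real.norm_of_nonneg hu0.le]
  have h5 : (σ k : ℝ) - t ≤ 4 * (u - t) := by linarith
  have h6 : ((σ k : ℝ) - t) ^ 2 ≤ (4 * (u - t)) ^ 2 := pow_le_pow_left₀ (hpos k).le h5 2
  have h7 : K * ((σ k : ℝ) - t) ^ 2 ≤ K * (4 * (u - t)) ^ 2 := mul_le_mul_of_nonneg_left h6 hK0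
  have h8 : (u - t) * ‖w - W k‖ ≤ (u - t) * (8 * K * (4 * (u - t))) :=
    mul_le_mul_of_nonneg_left (h3.trans (mul_le_mul_of_nonneg_left h5 (by positivity))) hu0.le
  nlinarith

end RightGerm

/-! ### Constancy of the weak order on right neighbourhoods -/

theorem intervalIntegral_eq_of_Ioo {φ : ℝ → ℝ} {a b x : ℝ} (hab : a ≤ b)
    (h : ∀ u ∈ Ioo a b, φ u = x) : ∫ u in a..b, φ u = (b - a) * x := by
  rw [intervalIntegral.integral_of_le hab, integral_Ioc_eq_integral_Ioo,
    setIntegral_congr_fun (g := fun _ => x) measurableSet_Ioo h, ← integral_Ioc_eq_integral_Ioo,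
    ← intervalIntegral.integral_of_le hab, intervalIntegral.integral_const, smul_eq_mul]

/-- The broken line with velocity `w` before the time `m` and `w + b` after it. -/
def brokenLine (X w b : EuclideanSpace ℝ (Fin N)) (t m u : ℝ) : EuclideanSpace ℝ (Fin N) :=
  X + (u - t) • w + max (u - m) 0 • b

section BrokenLine

variable (X w b : EuclideanSpace ℝ (Fin N)) (t m : ℝ)

theorem brokenLine_of_le {u : ℝ} (h : u ≤ m) : brokenLine X w b t m u = X + (u - t) • w := by
  simp [brokenLine, max_eq_right (sub_nonpos.2 h)]

theorem brokenLine_of_ge {u : ℝ} (h : m ≤ u) :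
    brokenLine X w b t m u = X + (u - t) • w + (u - m) • b := by
  simp [brokenLine, max_eq_left (sub_nonneg.2 h)]

theorem deriv_brokenLine_of_lt {u : ℝ} (h : u < m) : deriv (brokenLine X w b t m) u = w := by
  refine Eq.trans (Filter.EventuallyEq.deriv_eq ?_) (deriv_affine X w t u)
  filter_upwards [Iio_mem_nhds h] with v hv using brokenLine_of_le X w b t m (le_of_lt hv)

theorem deriv_brokenLine_of_gt {u : ℝ} (h : m < u) : deriv (brokenLine X w b t m) u = w + b := by
  have h1 : deriv (brokenLine X w b t m) u =
      deriv (fun u : ℝ => X + (u - t) • w + (u - m) • b) u := by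
    refine Filter.EventuallyEq.deriv_eq ?_
    filter_upwards [Ioi_mem_nhds h] with v hv using brokenLine_of_ge X w b t m (le_of_lt hv)
  have h2 := ((((hasDerivAt_id u).sub_const t).smul_const w).const_add X).add
    (((hasDerivAt_id u).sub_const m).smul_const b)
  rw [h1]
  simpa using! h2.deriv

theorem isH1Curve_brokenLine (c d : ℝ) : IsH1Curve (brokenLine X w b t m) c d := by
  have hLip : LipschitzWith ‖b‖₊ fun u : ℝ => max (u - m) 0 • b := by
    refine LipschitzWith.of_dist_le_mul fun x y => ?_
    rw [dist_eq_norm, ← sub_smul, norm_smul, mul_comm, Real.dist_eq]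
    refine mul_le_mul_of_nonneg_left ?_ (norm_nonneg _)
    simpa using abs_max_sub_max_le_abs (x - m) (y - m) 0
  have h1 : IsH1Curve (fun u : ℝ => max (u - m) 0 • b) c d := by
    refine ⟨hLip.lipschitzOnWith.absolutelyContinuousOnInterval, ?_⟩
    refine (intervalIntegrable_const (c := ‖b‖ ^ 2)).mono_fun
      ((measurable_deriv _).norm.pow_const 2).aestronglyMeasurable
      (Filter.Eventually.of_forall fun u => ?_)
    simp only [norm_pow, norm_norm]
    exact pow_le_pow_left₀ (norm_nonneg _) (norm_deriv_le_of_lipschitz hLip) 2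
  have h2 := (isH1Curve_of_contDiff (contDiff_affine X w t) c d).smul_add_smul h1 1 1
  simpa [brokenLine] using! h2

theorem integral_norm_deriv_brokenLine {s : ℝ} (htm : t ≤ m) (hms : m ≤ s) :
    ∫ u in t..s, ‖deriv (brokenLine X w b t m) u‖ ^ 2 =
      (m - t) * ‖w‖ ^ 2 + (s - m) * ‖w + b‖ ^ 2 := by
  rw [← intervalIntegral.integral_add_adjacent_intervals
    (isH1Curve_brokenLine X w b t m t m).sq (isH1Curve_brokenLine X w b t m m s).sq]
  congr 1
  · exact intervalIntegral_eq_of_Ioo htm fun u hu => by rw [deriv_brokenLine_of_lt _ _ _ _ _ hu.2]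
  · exact intervalIntegral_eq_of_Ioo hms fun u hu => by rw [deriv_brokenLine_of_gt _ _ _ _ _ hu.1]

end BrokenLine

section RightGerm

variable {A : EuclideanSpace ℝ (Fin N)} {T : ℝ} {Z : ℝ → EuclideanSpace ℝ (Fin N)}

/-- Starting from `Z_t` in the direction `w` and correcting the velocity at mid-time to reach `Z_s`
costs only a third order amount of kinetic energy when `w` is close to the slope of the chord.
Hence the cluster energy of `Z_t + δ w` cannot be smaller than that of `Z_s`. -/
theorem IsLocalMinimizer.compare_brokenLine (hA : StrictMono fun i => A i)
    (hZ : IsLocalMinimizer A T Z) {t s M C γ γ' : ℝ} (ht : 0 ≤ t) (hts : t < s) (hs : s ≤ T)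
    (hM : ∀ u ∈ Icc t s, ‖Z u‖ ≤ M) {w : EuclideanSpace ℝ (Fin N)} (hC : 0 ≤ C)
    (hw : ∀ u ∈ Icc t s, ‖Z u - (Z t + (u - t) • w)‖ ≤ C * (u - t) ^ 2)
    (hγ : ∀ u ∈ Ioo t s, γ ≤ clusterEnergy A (Z u)) (hγs : clusterEnergy A (Z s) = γ)
    (hγ' : ∀ δ ∈ Ioc 0 (s - t), clusterEnergy A (Z t + δ • w) = γ')
    (hsub : ∀ δ ∈ Ioc 0 (s - t), weakOrder (Z s) ⊆ weakOrder (Z t + δ • w)) :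
    γ ≤ γ' + 2 * (C ^ 2 + 6 * C * (M + 3 * C * (s - t) ^ 2 + ‖A‖)) * (s - t) ^ 2 := by
  set m := t + (s - t) / 2 with hm
  have hτ : 0 < s - t := by linarith
  have htm : t < m := by linarith
  have hms : m < s := by linarith
  have hmt : m - t = (s - t) / 2 := by rw [hm]; ring
  have hsm : s - m = (s - t) / 2 := by rw [hm]; ring
  set w' := chordSlope Z t s with hw'
  have hw's : (s - t) • w' = Z s - Z t := smul_chordSlope hts
  set b := (2 : ℝ) • (w' - w) with hb
  have hbn : ‖b‖ ≤ 2 * (C * (s - t)) := by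
    have h1 := hw s ⟨hts.le, le_rfl⟩
    have h2 : Z s - (Z t + (s - t) • w) = (s - t) • (w' - w) := by
      rw [smul_sub, hw's]; abel
    rw [h2, norm_smul, Real.norm_of_nonneg hτ.le] at h1
    have h3 : (s - t) * ‖w' - w‖ ≤ (s - t) * (C * (s - t)) := by linarith
    rw [hb, norm_smul, Real.norm_ofNat]
    linarith [le_of_mul_le_mul_left h3 hτ]
  set Y := brokenLine (Z t) w b t m with hY
  have hYt : Y t = Z t := by rw [hY, brokenLine_of_le _ _ _ _ _ htm.le]; simp
  have hYs : Y s = Z s := by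
    rw [hY, brokenLine_of_ge _ _ _ _ _ hms.le, hsm, hb, smul_smul,
      show (s - t) / 2 * 2 = s - t by ring, smul_sub, hw's]
    abel
  have hclose : ∀ u ∈ Icc t s, ‖Z u - Y u‖ ≤ 3 * C * (s - t) ^ 2 := by
    intro u hu
    have h1 : Z u - Y u = (Z u - (Z t + (u - t) • w)) - max (u - m) 0 • b := by
      rw [hY, brokenLine]; abel
    have h2 : max (u - m) 0 ≤ s - t := max_le (by linarith [hu.2]) hτ.le
    have h3 : (u - t) ^ 2 ≤ (s - t) ^ 2 :=
      pow_le_pow_left₀ (by linarith [hu.1]) (by linarith [hu.2]) 2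
    rw [h1]
    refine (norm_sub_le _ _).trans ?_
    rw [norm_smul, Real.norm_of_nonneg (le_max_right _ _)]
    have h4 : max (u - m) 0 * ‖b‖ ≤ (s - t) * (2 * (C * (s - t))) :=
      mul_le_mul h2 hbn (norm_nonneg _) hτ.le
    have h5 := (hw u hu).trans (mul_le_mul_of_nonneg_left h3 hC)
    nlinarith
  have hYM : ∀ u ∈ Icc t s, ‖Y u‖ ≤ M + 3 * C * (s - t) ^ 2 := by
    intro u hu
    have h1 := norm_sub_norm_le (Y u) (Z u)
    rw [norm_sub_rev] at h1
    linarith [hclose u hu, hM u hu]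
  have hZM : ∀ u ∈ Icc t s, ‖Z u‖ ≤ M + 3 * C * (s - t) ^ 2 := fun u hu =>
    (hM u hu).trans (by have : 0 ≤ 3 * C * (s - t) ^ 2 := by positivity
                        linarith)
  have hZ1 := hZ.isH1Curve ht hts.le hs
  have hY1 : ∀ c d, IsH1Curve Y c d := isH1Curve_brokenLine _ _ _ _ _
  have h1 := hZ.compare hA ht hts.le hs (hY1 t s) hYt hYs hZM hYM hclose
  rw [hY, integral_norm_deriv_brokenLine _ _ _ _ _ htm.le hms.le, ← hY] at h1
  -- the cluster energy of the broken line is `γ'` before the corner, and `γ` after it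
  have h2 : ∫ u in t..s, clusterEnergy A (Y u) = (m - t) * γ' + (s - m) * γ := by
    rw [← intervalIntegral.integral_add_adjacent_intervals
      (intervalIntegrable_clusterEnergy hA (hY1 t m).ac.continuousOn)
      (intervalIntegrable_clusterEnergy hA (hY1 m s).ac.continuousOn)]
    congr 1
    · refine intervalIntegral_eq_of_Ioo htm.le fun u hu => ?_
      rw [hY, brokenLine_of_le _ _ _ _ _ hu.2.le]
      exact hγ' _ ⟨by linarith [hu.1], by linarith [hu.2]⟩
    · refine intervalIntegral_eq_of_Ioo hms.le fun u hu => ?_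
      have hYm : Y m = Z t + (m - t) • w := by rw [hY, brokenLine_of_le _ _ _ _ _ le_rfl]
      have h3 : Y m + (u - m) • chordSlope Y m s = Y u := by
        have h4 : (s - m) • (w + b) = Y s - Y m := by
          rw [hYm, hY, brokenLine_of_ge _ _ _ _ _ hms.le, smul_add,
            show s - t = (s - m) + (m - t) by ring, add_smul]
          abel
        rw [chordSlope, ← h4, smul_smul (s - m)⁻¹, inv_mul_cancel₀ (by linarith), one_smul, hYm,
          hY, brokenLine_of_ge _ _ _ _ _ hu.1.le, smul_add,
          show u - t = (u - m) + (m - t) by ring, add_smul]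
        abel
      have h4 := weakOrder_chord (Z := Y) hms
        (by rw [hYs, hYm]; exact hsub _ ⟨by linarith, by linarith⟩) ⟨hu.1, hu.2.le⟩
      rw [h3, hYs] at h4
      rw [clusterEnergy_congr hA h4, hγs]
  have h3 : (s - t) * γ ≤ ∫ u in t..s, clusterEnergy A (Z u) := by
    rw [← intervalIntegral_eq_of_Ioo (φ := fun _ => γ) hts.le fun _ _ => rfl]
    refine intervalIntegral.integral_mono_on_of_le_Ioo hts.le intervalIntegrable_const
      (intervalIntegrable_clusterEnergy hA hZ1.ac.continuousOn) hγ
  have h4 : (s - t) * ‖w'‖ ^ 2 ≤ ∫ u in t..s, ‖deriv Z u‖ ^ 2 := by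
    have h5 := integral_norm_sub_chordSlope_sq hts hZ1
    have h6 : 0 ≤ ∫ u in t..s, ‖deriv Z u - chordSlope Z t s‖ ^ 2 :=
      intervalIntegral.integral_nonneg hts.le fun _ _ => sq_nonneg _
    rw [← hw'] at h5 h6
    linarith
  -- `w'` is the mean of the velocities `w` and `w + b` of the broken line
  have h5 : ‖w‖ ^ 2 + ‖w + b‖ ^ 2 = 2 * ‖w'‖ ^ 2 + ‖b‖ ^ 2 / 2 := by
    have h6 : w = w' - (1 / 2 : ℝ) • b := by
      rw [hb, smul_smul]; norm_num
    have h7 : w + b = w' + (1 / 2 : ℝ) • b := by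
      rw [hb, smul_smul, two_smul]; norm_num; abel
    have h8 := parallelogram_law_with_norm ℝ w' ((1 / 2 : ℝ) • b)
    rw [← h6, ← h7, norm_smul] at h8
    norm_num at h8
    nlinarith
  have h6 : ‖b‖ ^ 2 ≤ 4 * C ^ 2 * (s - t) ^ 2 := by
    have := pow_le_pow_left₀ (norm_nonneg _) hbn 2
    nlinarith
  rw [h2, hmt, hsm] at h1
  have h7 : (s - t) / 2 * ‖w‖ ^ 2 + (s - t) / 2 * ‖w + b‖ ^ 2 =
      (s - t) * ‖w'‖ ^ 2 + (s - t) / 4 * ‖b‖ ^ 2 := by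
    linear_combination ((s - t) / 2) * h5
  have h8 : (s - t) / 4 * ‖b‖ ^ 2 ≤ (s - t) / 4 * (4 * C ^ 2 * (s - t) ^ 2) :=
    mul_le_mul_of_nonneg_left h6 (by linarith)
  have h9 : (s - t) / 2 * γ ≤ (s - t) / 2 *
      (γ' + 2 * (C ^ 2 + 6 * C * (M + 3 * C * (s - t) ^ 2 + ‖A‖)) * (s - t) ^ 2) := by
    linarith
  exact le_of_mul_le_mul_left h9 (by linarith)

/-- Near `t⁺`, the curve `Z_t + δ w` has a constant weak order for small `δ > 0`, and `Z_s` has a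
finer one. -/
theorem exists_order_of_velocity {t ε C : ℝ} (hε : 0 < ε) {w : EuclideanSpace ℝ (Fin N)}
    (hw : ∀ u ∈ Icc t (t + ε), ‖Z u - (Z t + (u - t) • w)‖ ≤ C * (u - t) ^ 2) :
    ∃ O, (∀ᶠ s in nhdsWithin t (Ioi t), ∀ δ ∈ Ioc 0 (s - t), weakOrder (Z t + δ • w) = O) ∧
      ∀ᶠ s in nhdsWithin t (Ioi t), weakOrder (Z s) ⊆ O := by
  have h1 : ∀ᶠ δ : ℝ in nhdsWithin 0 (Ioi 0), weakOrder (Z t + δ • w) ⊆ weakOrder (Z t) := by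
    have hc : Continuous fun δ : ℝ => Z t + δ • w := by fun_prop
    have := (hc.tendsto 0).mono_left (nhdsWithin_le_nhds (s := Ioi (0 : ℝ)))
    simp only [zero_smul, add_zero] at this
    exact this.eventually (eventually_weakOrder_subset (Z t))
  obtain ⟨δ, hδsub, hδ⟩ := (h1.and self_mem_nhdsWithin).exists
  have hδ : 0 < δ := hδ
  refine ⟨weakOrder (Z t + δ • w), ?_, ?_⟩
  · have hmem : Iio (t + δ) ∈ nhdsWithin t (Ioi t) :=
      mem_nhdsWithin_of_mem_nhds (Iio_mem_nhds (by linarith))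
    filter_upwards [hmem] with s hs x hx
    have hxδ : x < δ := by have : s < t + δ := hs
                           linarith [hx.2]
    have h2 := weakOrder_combo hδsub (a := 1 - x / δ) (b := x / δ)
      (by rw [sub_nonneg, div_le_one hδ]; exact hxδ.le) (div_pos hx.1 hδ)
    rw [← h2, smul_add, smul_smul, div_mul_cancel₀ _ hδ.ne', ← add_assoc, ← add_smul]
    simp
  -- the blow-up `Z_t + (δ / (s - t)) (Z_s - Z_t)` tends to `Z_t + δ w`
  · have hlim : Filter.Tendsto (fun s => Z t + (δ / (s - t)) • (Z s - Z t))
        (nhdsWithin t (Ioi t)) (nhds (Z t + δ • w)) := by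
      rw [tendsto_iff_norm_sub_tendsto_zero]
      have hb : Filter.Tendsto (fun s : ℝ => δ * C * (s - t)) (nhdsWithin t (Ioi t)) (nhds 0) := by
        have hc : Continuous fun s : ℝ => δ * C * (s - t) := by fun_prop
        simpa using (hc.tendsto t).mono_left (nhdsWithin_le_nhds (s := Ioi t))
      refine squeeze_zero' (Filter.Eventually.of_forall fun _ => norm_nonneg _) ?_ hb
      have hmem : Iio (t + ε) ∈ nhdsWithin t (Ioi t) :=
        mem_nhdsWithin_of_mem_nhds (Iio_mem_nhds (by linarith))
      filter_upwards [hmem, self_mem_nhdsWithin] with s hs1 hs2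
      have hpos : 0 < s - t := sub_pos.2 hs2
      have h2 : Z t + (δ / (s - t)) • (Z s - Z t) - (Z t + δ • w) =
          (δ / (s - t)) • (Z s - (Z t + (s - t) • w)) := by
        have : δ / (s - t) * (s - t) = δ := div_mul_cancel₀ _ hpos.ne'
        rw [← sub_sub (Z s), smul_sub _ (Z s - Z t), smul_smul, this]
        abel
      rw [h2, norm_smul, Real.norm_of_nonneg (by positivity)]
      have h3 := mul_le_mul_of_nonneg_left (hw s ⟨le_of_lt hs2, le_of_lt hs1⟩)
        (show 0 ≤ δ / (s - t) by positivity)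
      refine h3.trans_eq ?_
      field_simp
    have hmem : Iio (t + δ) ∈ nhdsWithin t (Ioi t) :=
      mem_nhdsWithin_of_mem_nhds (Iio_mem_nhds (by linarith))
    filter_upwards [hlim.eventually (eventually_weakOrder_subset _), hmem, self_mem_nhdsWithin]
      with s hs1 hs2 hs3
    have hpos : 0 < s - t := sub_pos.2 hs3
    have hlt : s - t < δ := by have : s < t + δ := hs2
                               linarith
    have h2 := weakOrder_combo (hs1.trans hδsub) (a := 1 - (s - t) / δ) (b := (s - t) / δ)
      (by rw [sub_nonneg, div_le_one hδ]; exact hlt.le) (div_pos hpos hδ)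
    have h3 : (1 - (s - t) / δ) • Z t + ((s - t) / δ) • (Z t + (δ / (s - t)) • (Z s - Z t)) =
        Z s := by
      have : (s - t) / δ * (δ / (s - t)) = 1 := by field_simp
      rw [smul_add, smul_smul, this, one_smul, ← add_assoc, ← add_smul]
      simp
    rw [h3] at h2
    rw [h2]
    exact hs1

/-- If `Z_d` has a finer weak order than `Z_c` and `Z` stays close to a point on `[c, d]`, then the
cluster energy cannot exceed that of `Z_d` on all of `(c, d)`: otherwise it would do so by at least
the gap `κ`, and the chord would have a smaller action. -/
theorem IsLocalMinimizer.exists_clusterEnergy_le (hA : StrictMono fun i => A i)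
    (hZ : IsLocalMinimizer A T Z) {κ : ℝ}
    (hgap : ∀ X Y, clusterEnergy A X < clusterEnergy A Y →
      clusterEnergy A X + κ ≤ clusterEnergy A Y)
    {c d M η : ℝ} {X : EuclideanSpace ℝ (Fin N)} (hc : 0 ≤ c) (hcd : c < d) (hd : d ≤ T)
    (hM : ∀ u ∈ Icc c d, ‖Z u‖ ≤ M) (hη : ∀ u ∈ Icc c d, ‖Z u - X‖ ≤ η)
    (hord : weakOrder (Z d) ⊆ weakOrder (Z c)) (hsmall : 8 * (M + ‖A‖) * η < κ) :
    ∃ u ∈ Ioo c d, clusterEnergy A (Z u) ≤ clusterEnergy A (Z d) := by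
  by_contra hcon
  push Not at hcon
  have hZ1 := hZ.isH1Curve hc hcd.le hd
  have hcm := left_mem_Icc.2 hcd.le
  have hdm := right_mem_Icc.2 hcd.le
  have hclose : ∀ u ∈ Icc c d, ‖Z u - (Z c + (u - c) • chordSlope Z c d)‖ ≤ 4 * η := by
    intro u hu
    have h1 : ∀ v ∈ Icc c d, ‖Z v - Z c‖ ≤ 2 * η := fun v hv => by
      have h2 := norm_sub_le_norm_sub_add_norm_sub (Z v) X (Z c)
      have h3 := hη c hcm
      rw [norm_sub_rev] at h3
      linarith [hη v hv]
    have h2 : ‖(u - c) • chordSlope Z c d‖ ≤ ‖Z d - Z c‖ := by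
      rw [← smul_chordSlope hcd, norm_smul, norm_smul]
      refine mul_le_mul_of_nonneg_right ?_ (norm_nonneg _)
      rw [Real.norm_of_nonneg (by linarith [hu.1]), Real.norm_of_nonneg (by linarith)]
      linarith [hu.2]
    rw [← sub_sub]
    refine (norm_sub_le _ _).trans ?_
    linarith [h1 u hu, h1 d hdm]
  have h1 := hZ.compare_chord hA hc hcd hd hM hclose hord
  have h2 : 0 ≤ ∫ u in c..d, ‖deriv Z u - chordSlope Z c d‖ ^ 2 :=
    intervalIntegral.integral_nonneg hcd.le fun _ _ => sq_nonneg _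
  have h3 : (d - c) * (clusterEnergy A (Z d) + κ) ≤ ∫ u in c..d, clusterEnergy A (Z u) := by
    rw [← intervalIntegral_eq_of_Ioo (φ := fun _ => clusterEnergy A (Z d) + κ) hcd.le
      fun _ _ => rfl]
    exact intervalIntegral.integral_mono_on_of_le_Ioo hcd.le intervalIntegrable_const
      (intervalIntegrable_clusterEnergy hA hZ1.ac.continuousOn) fun u hu => hgap _ _ (hcon u hu)
  have h4 : (d - c) * κ ≤ (d - c) * (8 * (M + ‖A‖) * η) := by nlinarith
  exact absurd (le_of_mul_le_mul_left h4 (by linarith)) (not_le.2 hsmall)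

/-- The weak order of a minimizer is constant on a right neighbourhood of each time. -/
theorem IsLocalMinimizer.eventually_weakOrder_eq (hA : StrictMono fun i => A i)
    (hZ : IsLocalMinimizer A T Z) {t : ℝ} (ht : t ∈ Ico 0 T) :
    ∃ O, ∀ᶠ s in nhdsWithin t (Ioi t), weakOrder (Z s) = O := by
  have hT : 0 ≤ T := ht.1.trans ht.2.le
  have hcont := hZ.continuousOn hT
  obtain ⟨M, hM⟩ := isCompact_Icc.exists_bound_of_continuousOn hcont
  have hM0 : 0 ≤ M := (norm_nonneg _).trans (hM t (Ico_subset_Icc_self ht))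
  obtain ⟨κ, hκ, hgap⟩ := exists_clusterEnergy_gap hA
  have htend := tendsto_nhdsGT_of_continuousOn hcont ht
  have small : ∀ φ : ℝ → ℝ, Continuous φ → φ t = 0 → ∀ ρ > 0,
      ∀ᶠ s in nhdsWithin t (Ioi t), φ s < ρ := fun φ hφ h0 ρ hρ =>
    ((hφ.tendsto t).mono_left nhdsWithin_le_nhds).eventually (gt_mem_nhds (by rw [h0]; exact hρ))
  obtain ⟨γ, hfreq, hγ⟩ := exists_frequently_eq_eventually_le (l := nhdsWithin t (Ioi t))
    (φ := fun s => clusterEnergy A (Z s))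
    ((finite_range_clusterEnergy hA).subset (range_comp_subset_range Z (clusterEnergy A)))
  have hsub := htend.eventually (eventually_weakOrder_subset (Z t))
  have hT' : ∀ᶠ s in nhdsWithin t (Ioi t), s < T :=
    mem_nhdsWithin_of_mem_nhds (Iio_mem_nhds ht.2)
  have toInterval : ∀ {p : ℝ → Prop}, (∀ᶠ s in nhdsWithin t (Ioi t), p s) →
      ∀ᶠ s in nhdsWithin t (Ioi t), ∀ u ∈ Ioc t s, p u := by
    intro p hp
    obtain ⟨e, he, hep⟩ := mem_nhdsGT_iff_exists_Ioo_subset.1 hp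
    have he : t < e := he
    filter_upwards [mem_nhdsWithin_of_mem_nhds (Iio_mem_nhds he)] with s hs u hu
    exact hep ⟨hu.1, hu.2.trans_lt hs⟩
  -- the right velocity
  obtain ⟨s₀, hs₀γ, ⟨⟨hs₀min, hs₀sub⟩, hs₀T⟩, hs₀small, hts₀⟩ := (hfreq.and_eventually
    (((toInterval hγ).and (toInterval hsub)).and hT' |>.and
      ((small (fun s => 4 * (2 * (M + ‖A‖)) ^ 2 * (s - t) ^ 2) (by fun_prop) (by simp) κ hκ).and
        self_mem_nhdsWithin))).exists
  have hts₀ : t < s₀ := hts₀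
  obtain ⟨w, C, hC, hw⟩ := hZ.exists_right_velocity hA ht.1 hts₀ hs₀T.le
    (fun u hu => hM u ⟨ht.1.trans hu.1, hu.2.trans hs₀T.le⟩) hgap hs₀sub hs₀min hs₀γ hs₀small
  obtain ⟨O, hO1, hO2⟩ := exists_order_of_velocity (Z := Z) (t := t) (ε := s₀ - t) (C := C)
    (by linarith) (w := w) (by rw [add_sub_cancel]; exact hw)
  -- good times have the weak order of the velocity
  have hgood : ∀ᶠ s in nhdsWithin t (Ioi t), clusterEnergy A (Z s) = γ → weakOrder (Z s) = O := by
    filter_upwards [toInterval hγ, hT', hO1, hO2, self_mem_nhdsWithin,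
      mem_nhdsWithin_of_mem_nhds (Iio_mem_nhds hts₀),
      small (fun s => 2 * (C ^ 2 + 6 * C * (M + 3 * C * (s - t) ^ 2 + ‖A‖)) * (s - t) ^ 2)
        (by fun_prop) (by simp) κ hκ] with s h1 h2 h3 h4 hts h5 h6 hsγ
    have hts : t < s := hts
    have h5 : s < s₀ := h5
    have hlast : s - t ∈ Ioc 0 (s - t) := ⟨by linarith, le_rfl⟩
    have h7 := hZ.compare_brokenLine hA (γ' := clusterEnergy A (Z t + (s - t) • w)) ht.1 hts h2.le
      (fun u hu => hM u ⟨ht.1.trans hu.1, hu.2.trans h2.le⟩) hC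
      (fun u hu => hw u ⟨hu.1, hu.2.trans h5.le⟩) (fun u hu => h1 u ⟨hu.1, hu.2.le⟩) hsγ
      (fun δ hδ => clusterEnergy_congr hA (by rw [h3 δ hδ, h3 _ hlast]))
      (fun δ hδ => by rw [h3 δ hδ]; exact h4)
    rw [← h3 _ hlast]
    refine weakOrder_eq_of_clusterEnergy_le hA (by rw [h3 _ hlast]; exact h4) ?_
    by_contra hlt
    have h8 := hgap _ _ (not_le.1 hlt)
    rw [hsγ] at h8
    linarith
  -- all times are good
  have hη : 0 < κ / (16 * (M + ‖A‖ + 1)) := by positivity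
  have hclose : ∀ᶠ s in nhdsWithin t (Ioi t), ‖Z s - Z t‖ ≤ κ / (16 * (M + ‖A‖ + 1)) := by
    filter_upwards [htend.eventually (Metric.closedBall_mem_nhds (Z t) hη)] with s hs
    rwa [← dist_eq_norm]
  have hsmall : 8 * (M + ‖A‖) * (κ / (16 * (M + ‖A‖ + 1))) < κ := by
    have h0 : 0 < M + ‖A‖ + 1 := by positivity
    rw [mul_div_assoc', div_lt_iff₀ (by positivity)]
    nlinarith [norm_nonneg A]
  have hev := ((hγ.and hgood).and hclose).and hT'
  obtain ⟨s₁, hs₁γ, hs₁, hts₁⟩ :=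
    (hfreq.and_eventually ((toInterval hev).and self_mem_nhdsWithin)).exists
  have hts₁ : t < s₁ := hts₁
  refine ⟨O, ?_⟩
  filter_upwards [Ioo_mem_nhdsGT hts₁] with u hu
  refine (hs₁ u ⟨hu.1, hu.2.le⟩).1.1.2 ?_
  by_contra hbad
  -- `c` and `d` are the last good time before `u` and the first good time after `u`
  obtain ⟨c₀, hc₀γ, hc₀⟩ := (hfreq.and_eventually (Ioo_mem_nhdsGT hu.1)).exists
  have hclosed : ∀ a b : ℝ, t < a → b ≤ s₁ →
      IsCompact (Icc a b ∩ Z ⁻¹' (clusterEnergy A ⁻¹' Iic γ)) := by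
    intro a b ha hb
    refine isCompact_Icc.of_isClosed_subset (ContinuousOn.preimage_isClosed_of_isClosed
      (hcont.mono (Icc_subset_Icc (ht.1.trans ha.le) ?_)) isClosed_Icc
      ((lowerSemicontinuous_clusterEnergy hA).isClosed_preimage γ)) inter_subset_left
    exact hb.trans (hs₁ s₁ ⟨hts₁, le_rfl⟩).2.le
  obtain ⟨c, ⟨hcI, hcγ⟩, hcmax⟩ := (hclosed c₀ u hc₀.1 hu.2.le).exists_isGreatest
    ⟨c₀, ⟨le_rfl, hc₀.2.le⟩, hc₀γ.le⟩
  obtain ⟨d, ⟨hdI, hdγ⟩, hdmin⟩ := (hclosed u s₁ hu.1 le_rfl).exists_isLeast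
    ⟨s₁, ⟨hu.2.le, le_rfl⟩, hs₁γ.le⟩
  have hbetween : ∀ v, c < v → v < d → γ < clusterEnergy A (Z v) := by
    intro v hcv hvd
    by_contra hv
    rw [not_lt] at hv
    rcases le_total v u with h | h
    · exact absurd (hcmax ⟨⟨hcI.1.trans hcv.le, h⟩, hv⟩) (not_le.2 hcv)
    · exact absurd (hdmin ⟨⟨h, hvd.le.trans hdI.2⟩, hv⟩) (not_le.2 hvd)
  have htc : t < c := hc₀.1.trans_le hcI.1
  have hmem : ∀ v ∈ Icc c d, v ∈ Ioc t s₁ := fun v hv =>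
    ⟨htc.trans_le hv.1, hv.2.trans hdI.2⟩
  have hubad : γ < clusterEnergy A (Z u) :=
    lt_of_le_of_ne (hs₁ u ⟨hu.1, hu.2.le⟩).1.1.1 (Ne.symm hbad)
  have hcu : c ≠ u := by rintro rfl; exact absurd hcγ (not_le.2 hubad)
  have hcd : c < d := (lt_of_le_of_ne hcI.2 hcu).trans_le hdI.1
  have hcm := hs₁ c (hmem c (left_mem_Icc.2 hcd.le))
  have hdm := hs₁ d (hmem d (right_mem_Icc.2 hcd.le))
  have hcO := hcm.1.1.2 (le_antisymm hcγ hcm.1.1.1)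
  have hdγ' : clusterEnergy A (Z d) = γ := le_antisymm hdγ hdm.1.1.1
  have hdO := hdm.1.1.2 hdγ'
  obtain ⟨v, hv, hvle⟩ := hZ.exists_clusterEnergy_le hA hgap (ht.1.trans htc.le) hcd hdm.2.le
    (fun v hv => hM v ⟨ht.1.trans (hmem v hv).1.le, (hs₁ v (hmem v hv)).2.le⟩)
    (fun v hv => (hs₁ v (hmem v hv)).1.2) (by rw [hcO, hdO]) hsmall
  rw [hdγ'] at hvle
  exact absurd hvle (not_le.2 (hbetween v hv.1 hv.2))

end RightGerm

/-! ### Time reversal and finiteness of the set of events -/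

theorem uIoc_disjoint_iff {x y x' y' : ℝ} :
    Disjoint (uIoc x y) (uIoc x' y') ↔ min (max x y) (max x' y') ≤ max (min x y) (min x' y') :=
  Set.Ioc_disjoint_Ioc

/-- Absolute continuity is preserved by a monotone or antitone `1`-Lipschitz change of variables. -/
theorem absolutelyContinuousOnInterval_comp {X : Type*} [PseudoMetricSpace X] {f : ℝ → X}
    {a b c d : ℝ} (hf : AbsolutelyContinuousOnInterval f c d) {φ : ℝ → ℝ} (hφ : LipschitzWith 1 φ)
    (hmono : Monotone φ ∨ Antitone φ) (hmaps : MapsTo φ (uIcc a b) (uIcc c d)) :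
    AbsolutelyContinuousOnInterval (fun t => f (φ t)) a b := by
  rw [absolutelyContinuousOnInterval_iff] at hf ⊢
  intro ε hε
  obtain ⟨δ, hδ, h⟩ := hf ε hε
  refine ⟨δ, hδ, fun E hE hsum => ?_⟩
  refine h (E.1, fun i => (φ (E.2 i).1, φ (E.2 i).2)) ⟨fun i hi => ?_, fun i hi j hj hij => ?_⟩ ?_
  · exact ⟨hmaps (hE.1 i hi).1, hmaps (hE.1 i hi).2⟩
  · have h1 := uIoc_disjoint_iff.1 (hE.2 hi hj hij)
    refine uIoc_disjoint_iff.2 ?_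
    rcases hmono with hm | hm
    · simp only [← hm.map_max, ← hm.map_min]
      exact hm h1
    · simp only [← hm.map_max, ← hm.map_min]
      exact hm h1
  · refine lt_of_le_of_lt (Finset.sum_le_sum fun i _ => ?_) hsum
    simpa using hφ.dist_le_mul (E.2 i).1 (E.2 i).2

theorem IsH1Curve.reverse {Y : ℝ → EuclideanSpace ℝ (Fin N)} {c d : ℝ} (T : ℝ)
    (hcd : c ≤ d) (h : IsH1Curve Y c d) : IsH1Curve (fun t => Y (T - t)) (T - d) (T - c) := by
  refine ⟨absolutelyContinuousOnInterval_comp h.ac (φ := fun t => T - t) ?_ (Or.inr ?_) ?_, ?_⟩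
  · exact LipschitzWith.of_dist_le_mul fun x y => by
      rw [Real.dist_eq, Real.dist_eq, sub_sub_sub_cancel_left, abs_sub_comm]
      simp
  · intro x y hxy
    simp only
    linarith
  · intro t ht
    rw [uIcc_of_le (by linarith)] at ht
    rw [uIcc_of_le hcd]
    exact ⟨by linarith [ht.2], by linarith [ht.1]⟩
  · have := (h.sq.comp_sub_left T).symm
    refine this.congr fun t _ => ?_
    rw [deriv_comp_const_sub, norm_neg]

theorem lagrangian_reverse (A : EuclideanSpace ℝ (Fin N)) (Y : ℝ → EuclideanSpace ℝ (Fin N))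
    (T t : ℝ) : lagrangian A (fun t => Y (T - t)) t = lagrangian A Y (T - t) := by
  simp only [lagrangian]
  rw [deriv_comp_const_sub, norm_neg]

section Germs

variable {A : EuclideanSpace ℝ (Fin N)} {T : ℝ} {Z : ℝ → EuclideanSpace ℝ (Fin N)}

theorem IsLocalMinimizer.reverse (hT : 0 ≤ T) (hZ : IsLocalMinimizer A T Z) :
    IsLocalMinimizer A T fun t => Z (T - t) := by
  refine ⟨by simpa using hZ.curve.reverse T hT, fun c d hc hcd hd Y hY hYc hYd => ?_⟩
  have h := hZ.le (T - d) (T - c) (by linarith) (by linarith) (by linarith)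
    (fun t => Y (T - t)) (hY.reverse T hcd) (by simpa using hYd) (by simpa using hYc)
  simp only [lagrangian_reverse] at h ⊢
  rw [intervalIntegral.integral_comp_sub_left (lagrangian A Z)]
  rw [intervalIntegral.integral_comp_sub_left (lagrangian A Y)] at h
  simpa using h

theorem IsLocalMinimizer.eventually_weakOrder_eq_left (hA : StrictMono fun i => A i)
    (hZ : IsLocalMinimizer A T Z) {t : ℝ} (ht : t ∈ Ioc 0 T) :
    ∃ O, ∀ᶠ s in nhdsWithin t (Iio t), weakOrder (Z s) = O := by
  have hT : 0 ≤ T := ht.1.le.trans ht.2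
  obtain ⟨O, hO⟩ := (hZ.reverse hT).eventually_weakOrder_eq hA (t := T - t)
    ⟨by linarith [ht.2], by linarith [ht.1]⟩
  refine ⟨O, ?_⟩
  have hc : Continuous fun s : ℝ => T - s := by fun_prop
  have htend : Filter.Tendsto (fun s : ℝ => T - s) (nhdsWithin t (Iio t))
      (nhdsWithin (T - t) (Ioi (T - t))) :=
    hc.continuousWithinAt.tendsto_nhdsWithin fun s hs => by
      have : s < t := hs
      simp only [mem_Ioi]; linarith
  filter_upwards [htend.eventually hO] with s hs
  simpa using hs

/-- The times in `[0, T]` near which the weak order of `Z` is not constant. -/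
def eventTimes (T : ℝ) (Z : ℝ → EuclideanSpace ℝ (Fin N)) : Set ℝ :=
  {t ∈ Icc 0 T | ¬ ∀ᶠ s in nhdsWithin t (Icc 0 T), weakOrder (Z s) = weakOrder (Z t)}

theorem notMem_eventTimes_of_Ioo {a b : ℝ} {O : Set (Fin N × Fin N)}
    (h : ∀ s ∈ Ioo a b, weakOrder (Z s) = O) {t : ℝ} (ht : t ∈ Ioo a b) :
    t ∉ eventTimes T Z := by
  rintro ⟨-, hcon⟩
  refine hcon (mem_nhdsWithin_of_mem_nhds ?_)
  filter_upwards [Ioo_mem_nhds ht.1 ht.2] with s hs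
  rw [h s hs, h t ht]

theorem IsLocalMinimizer.finite_eventTimes (hA : StrictMono fun i => A i)
    (hZ : IsLocalMinimizer A T Z) : (eventTimes T Z).Finite := by
  by_contra hinf
  obtain ⟨x, hx, hacc⟩ := Set.Infinite.exists_accPt_of_subset_isCompact hinf isCompact_Icc
    (sep_subset _ _)
  rw [accPt_iff_frequently_nhdsNE] at hacc
  refine hacc ?_
  rw [← Iio_union_Ioi, nhdsWithin_union, Filter.eventually_sup]
  constructor
  · rcases hx.1.eq_or_lt with h | h
    · filter_upwards [self_mem_nhdsWithin] with s hs hmem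
      have : s < x := hs
      linarith [hmem.1.1]
    · obtain ⟨O, hO⟩ := hZ.eventually_weakOrder_eq_left hA ⟨h, hx.2⟩
      obtain ⟨e, he, hsub⟩ := mem_nhdsLT_iff_exists_Ioo_subset.1 hO
      filter_upwards [Ioo_mem_nhdsLT he] with s hs
      exact notMem_eventTimes_of_Ioo hsub hs
  · rcases hx.2.eq_or_lt with h | h
    · filter_upwards [self_mem_nhdsWithin] with s hs hmem
      have : x < s := hs
      linarith [hmem.1.2]
    · obtain ⟨O, hO⟩ := hZ.eventually_weakOrder_eq hA ⟨hx.1, h⟩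
      obtain ⟨e, he, hsub⟩ := mem_nhdsGT_iff_exists_Ioo_subset.1 hO
      filter_upwards [Ioo_mem_nhdsGT he] with s hs
      exact notMem_eventTimes_of_Ioo hsub hs

theorem weakOrder_eq_of_disjoint_eventTimes {a b : ℝ} (ha : 0 ≤ a) (hb : b ≤ T)
    (h : ∀ s ∈ Ioo a b, s ∉ eventTimes T Z) :
    ∀ r ∈ Ioo a b, ∀ s ∈ Ioo a b, weakOrder (Z r) = weakOrder (Z s) := by
  intro r hr s hs
  have hsub : Ioo a b ⊆ Icc 0 T := fun u hu => ⟨ha.trans hu.1.le, hu.2.le.trans hb⟩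
  refine isPreconnected_Ioo.induction₂ (fun r s => weakOrder (Z r) = weakOrder (Z s))
    (fun x hx => ?_) (fun x y z _ _ _ h1 h2 => h1.trans h2) (fun x y _ _ h1 => h1.symm) hr hs
  have h1 := h x hx
  simp only [eventTimes, mem_ofPred_eq, not_and, not_not] at h1
  filter_upwards [nhdsWithin_mono x hsub (h1 (hsub hx))] with y hy using hy.symm

/-- A finite subset `B` of `[0, T]`, enlarged by `0` and `T`, cuts `[0, T]` into finitely many
intervals whose interiors avoid `B`. -/
theorem exists_subdivision (hT : 0 < T) {B : Set ℝ} (hB : B.Finite) (hsub : B ⊆ Icc 0 T) :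
    ∃ (p : ℕ) (t : Fin (p + 1) → ℝ), StrictMono t ∧ t 0 = 0 ∧ t (Fin.last p) = T ∧
      ∀ i : Fin p, 0 ≤ t i.castSucc ∧ t i.succ ≤ T ∧
        ∀ s ∈ Ioo (t i.castSucc) (t i.succ), s ∉ B := by
  classical
  set F : Finset ℝ := insert 0 (insert T hB.toFinset) with hF
  have hmem : ∀ {x}, x ∈ F ↔ x = 0 ∨ x = T ∨ x ∈ B := by simp [hF]
  have hIcc : ∀ x ∈ F, x ∈ Icc 0 T := by
    intro x hx
    rcases hmem.1 hx with rfl | rfl | h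
    · exact ⟨le_rfl, hT.le⟩
    · exact ⟨hT.le, le_rfl⟩
    · exact hsub h
  obtain ⟨p, hp⟩ : ∃ p, F.card = p + 1 :=
    Nat.exists_eq_succ_of_ne_zero (Finset.card_ne_zero_of_mem (hmem.2 (Or.inl rfl)))
  set t := F.orderEmbOfFin hp with ht
  have hrange : ∀ x ∈ F, ∃ j, t j = x := fun x hx => by
    have : x ∈ range t := by rw [ht, Finset.range_orderEmbOfFin]; exact hx
    exact this
  have htF : ∀ j, t j ∈ Icc 0 T := fun j => hIcc _ (Finset.orderEmbOfFin_mem F hp j)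
  refine ⟨p, t, t.strictMono, ?_, ?_, fun i => ⟨(htF _).1, (htF _).2, fun s hs hsB => ?_⟩⟩
  · obtain ⟨j, hj⟩ := hrange 0 (hmem.2 (Or.inl rfl))
    exact le_antisymm (hj ▸ t.monotone (Fin.zero_le j)) (htF 0).1
  · obtain ⟨j, hj⟩ := hrange T (hmem.2 (Or.inr (Or.inl rfl)))
    exact le_antisymm (htF _).2 (hj.symm.trans_le (t.monotone (Fin.le_last j)))
  · obtain ⟨j, rfl⟩ := hrange s (hmem.2 (Or.inr (Or.inr hsB)))
    have h1 : i.castSucc < j := t.lt_iff_lt.1 hs.1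
    have h2 : j < i.succ := t.lt_iff_lt.1 hs.2
    rw [Fin.lt_def] at h1 h2
    simp at h1 h2
    omega

end Germs

/-! ### Smoothness between events -/

theorem ae_hasDerivAt_inner {h : ℝ → EuclideanSpace ℝ (Fin N)} {c d : ℝ}
    (hh : AbsolutelyContinuousOnInterval h c d) (X : EuclideanSpace ℝ (Fin N)) :
    ∀ᵐ t, t ∈ uIcc c d → HasDerivAt (fun t => ⟪X, h t⟫_ℝ) ⟪X, deriv h t⟫_ℝ t := by
  filter_upwards [ae_differentiableAt_of_ac hh] with t ht htm
  simpa using (hasDerivAt_const t X).inner ℝ (ht htm).hasDerivAt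

/-- Integration by parts: a solution of `φ'' = φ` is orthogonal in `H¹` to the functions vanishing
at the endpoints. -/
theorem integral_inner_eq_zero_of_vanishing {h : ℝ → EuclideanSpace ℝ (Fin N)} {c d : ℝ}
    (hh : IsH1Curve h c d) (hc : h c = 0) (hd : h d = 0) (X : EuclideanSpace ℝ (Fin N))
    {φ φ' : ℝ → ℝ} (hφ : ∀ t, HasDerivAt φ (φ' t) t) (hφ' : ∀ t, HasDerivAt φ' (φ t) t) :
    IntervalIntegrable (fun t => φ' t * ⟪X, deriv h t⟫_ℝ + φ t * ⟪X, h t⟫_ℝ) volume c d ∧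
    ∫ t in c..d, (φ' t * ⟪X, deriv h t⟫_ℝ + φ t * ⟪X, h t⟫_ℝ) = 0 := by
  have hφc : Continuous φ := continuous_iff_continuousAt.2 fun t => (hφ t).continuousAt
  have hφ'c : Continuous φ' := continuous_iff_continuousAt.2 fun t => (hφ' t).continuousAt
  have hder : deriv φ' = φ := funext fun t => (hφ' t).deriv
  have hφ'1 : ContDiff ℝ 1 φ' :=
    contDiff_one_iff_deriv.2 ⟨fun t => (hφ' t).differentiableAt, by rw [hder]; exact hφc⟩
  have hg : AbsolutelyContinuousOnInterval (fun t => ⟪X, h t⟫_ℝ) c d :=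
    absolutelyContinuousOnInterval_lipschitz_comp (innerSL ℝ X).lipschitz hh.ac
  have h1 := hφ'1.contDiffOn.absolutelyContinuousOnInterval.integral_deriv_mul_eq_sub hg
  constructor
  · exact ((intervalIntegrable_const_inner hh.intervalIntegrable_deriv X).continuousOn_mul
      hφ'c.continuousOn).add ((hφc.continuousOn.mul hg.continuousOn).intervalIntegrable)
  · simp only [hc, hd, inner_zero_right, mul_zero, sub_zero, hder] at h1
    rw [← h1]
    refine intervalIntegral.integral_congr_ae ?_
    filter_upwards [ae_hasDerivAt_inner hh.ac X] with t ht htm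
    rw [(ht (uIoc_subset_uIcc htm)).deriv, add_comm]

/-- A small perturbation along `Y - Z` which respects the clusters of `Z` keeps the weak order of
`Z`, uniformly on a compact interval. -/
theorem eventually_weakOrder_combo {Y Z : ℝ → EuclideanSpace ℝ (Fin N)} {c d : ℝ}
    (hY : ContinuousOn Y (Icc c d)) (hZ : ContinuousOn Z (Icc c d)) {O : Set (Fin N × Fin N)}
    (hO : ∀ t ∈ Icc c d, weakOrder (Z t) = O)
    (hYZ : ∀ t ∈ Icc c d, ∀ i j, Z t i = Z t j → Y t i = Y t j) :
    ∀ᶠ ε : ℝ in nhdsWithin 0 (Ioi 0), ∀ t ∈ Icc c d,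
      weakOrder ((1 - ε) • Z t + ε • Y t) = O := by
  rcases (Icc c d).eq_empty_or_nonempty with hem | hne
  · simp [hem]
  have hcoord : ∀ {W : ℝ → EuclideanSpace ℝ (Fin N)}, ContinuousOn W (Icc c d) → ∀ i j,
      ContinuousOn (fun t => W t j - W t i) (Icc c d) := by
    intro W hW i j
    have hp : Continuous fun X : EuclideanSpace ℝ (Fin N) => X j - X i := by fun_prop
    exact hp.comp_continuousOn hW
  have key : ∀ q : Fin N × Fin N, ∀ᶠ ε : ℝ in nhdsWithin 0 (Ioi 0), ∀ t ∈ Icc c d,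
      Z t q.1 < Z t q.2 → ((1 - ε) • Z t + ε • Y t) q.1 < ((1 - ε) • Z t + ε • Y t) q.2 := by
    rintro ⟨i, j⟩
    by_cases hij : (j, i) ∈ O
    · refine Filter.Eventually.of_forall fun ε t ht hlt => ?_
      rw [← hO t ht] at hij
      exact absurd hlt (not_lt.2 hij)
    obtain ⟨t₀, ht₀, hmin⟩ := isCompact_Icc.exists_isMinOn hne (hcoord hZ i j)
    obtain ⟨C, hC⟩ := isCompact_Icc.exists_bound_of_continuousOn
      ((hcoord hY i j).sub (hcoord hZ i j))
    have hpos : 0 < Z t₀ j - Z t₀ i := by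
      rw [← hO t₀ ht₀, mem_weakOrder, not_le] at hij
      linarith
    have hev : ∀ᶠ ε : ℝ in nhdsWithin 0 (Ioi 0), ε * C < Z t₀ j - Z t₀ i := by
      have hc : Continuous fun ε : ℝ => ε * C := by fun_prop
      have := (hc.tendsto 0).mono_left (nhdsWithin_le_nhds (s := Ioi (0 : ℝ)))
      exact this.eventually (gt_mem_nhds (by simpa using hpos))
    filter_upwards [hev, self_mem_nhdsWithin] with ε hε hε0 t ht _
    have hε0 : 0 < ε := hε0
    have h1 : Z t₀ j - Z t₀ i ≤ Z t j - Z t i := hmin ht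
    have h2 := hC t ht
    rw [Real.norm_eq_abs] at h2
    have h3 := mul_le_mul_of_nonneg_left (abs_le.1 h2).1 hε0.le
    simp only [PiLp.add_apply, PiLp.smul_apply, smul_eq_mul]
    simp only [Pi.sub_apply, mul_sub, mul_neg] at h3
    linarith
  filter_upwards [Filter.eventually_all.2 key] with ε hε t ht
  ext ⟨i, j⟩
  rw [← hO t ht, mem_weakOrder, mem_weakOrder]
  constructor
  · intro hle
    by_contra hlt
    exact absurd (hε (j, i) t ht (not_le.1 hlt)) (not_lt.2 hle)
  · intro hle
    rcases hle.eq_or_lt with heq | hlt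
    · simp only [PiLp.add_apply, PiLp.smul_apply, smul_eq_mul, heq, hYZ t ht i j heq]
      exact le_rfl
    · exact (hε (i, j) t ht hlt).le

/-- The solution of `Y'' = Y - p` with values `X₁` at `c` and `X₂` at `d`. -/
def hyperbolicArc (p X₁ X₂ : EuclideanSpace ℝ (Fin N)) (c d t : ℝ) : EuclideanSpace ℝ (Fin N) :=
  p + (Real.sinh (d - t) • ((Real.sinh (d - c))⁻¹ • (X₁ - p)) +
    Real.sinh (t - c) • ((Real.sinh (d - c))⁻¹ • (X₂ - p)))

theorem contDiff_hyperbolicArc (p X₁ X₂ : EuclideanSpace ℝ (Fin N)) (c d : ℝ) :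
    ContDiff ℝ ∞ (hyperbolicArc p X₁ X₂ c d) := by
  unfold hyperbolicArc
  have h1 : ContDiff ℝ ∞ fun t : ℝ => Real.sinh (d - t) :=
    Real.contDiff_sinh.comp (contDiff_const.sub contDiff_id)
  have h2 : ContDiff ℝ ∞ fun t : ℝ => Real.sinh (t - c) :=
    Real.contDiff_sinh.comp (contDiff_id.sub contDiff_const)
  exact contDiff_const.add ((h1.smul contDiff_const).add (h2.smul contDiff_const))

theorem hyperbolicArc_left {c d : ℝ} (h : c < d) (p X₁ X₂ : EuclideanSpace ℝ (Fin N)) :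
    hyperbolicArc p X₁ X₂ c d c = X₁ := by
  have : Real.sinh (d - c) ≠ 0 := (Real.sinh_pos_iff.2 (by linarith)).ne'
  simp [hyperbolicArc, smul_smul, this]

theorem hyperbolicArc_right {c d : ℝ} (h : c < d) (p X₁ X₂ : EuclideanSpace ℝ (Fin N)) :
    hyperbolicArc p X₁ X₂ c d d = X₂ := by
  have : Real.sinh (d - c) ≠ 0 := (Real.sinh_pos_iff.2 (by linarith)).ne'
  simp [hyperbolicArc, smul_smul, this]

theorem sinh_mul_sinh_identity (a b c d : ℝ) :
    Real.sinh (b - a) * Real.sinh (d - c) =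
      Real.sinh (b - c) * Real.sinh (d - a) + Real.sinh (c - a) * Real.sinh (d - b) := by
  simp only [Real.sinh_sub]
  ring

/-- A solution of `Y'' = Y - p` is determined by its values at two times `m < n`. -/
theorem hyperbolicArc_restart (p X₁ X₂ : EuclideanSpace ℝ (Fin N)) (c d : ℝ) {m n : ℝ}
    (h : m < n) (t : ℝ) :
    hyperbolicArc p (hyperbolicArc p X₁ X₂ c d m) (hyperbolicArc p X₁ X₂ c d n) m n t =
      hyperbolicArc p X₁ X₂ c d t := by
  have hne : Real.sinh (n - m) ≠ 0 := (Real.sinh_pos_iff.2 (by linarith)).ne'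
  set U := (Real.sinh (d - c))⁻¹ • (X₁ - p) with hU
  set V := (Real.sinh (d - c))⁻¹ • (X₂ - p) with hV
  have hdef : ∀ s, hyperbolicArc p X₁ X₂ c d s =
      p + (Real.sinh (d - s) • U + Real.sinh (s - c) • V) := fun s => rfl
  rw [hdef m, hdef n, hdef t, hyperbolicArc, add_sub_cancel_left, add_sub_cancel_left]
  congr 1
  simp only [smul_add, smul_smul]
  have h1 : Real.sinh (n - t) * ((Real.sinh (n - m))⁻¹ * Real.sinh (d - m)) +
      Real.sinh (t - m) * ((Real.sinh (n - m))⁻¹ * Real.sinh (d - n)) = Real.sinh (d - t) := by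
    field_simp
    linarith [sinh_mul_sinh_identity m n t d]
  have h2 : Real.sinh (n - t) * ((Real.sinh (n - m))⁻¹ * Real.sinh (m - c)) +
      Real.sinh (t - m) * ((Real.sinh (n - m))⁻¹ * Real.sinh (n - c)) = Real.sinh (t - c) := by
    have h3 := sinh_mul_sinh_identity m n t c
    rw [← neg_sub c t, ← neg_sub c m, ← neg_sub c n, Real.sinh_neg, Real.sinh_neg, Real.sinh_neg]
    field_simp
    linarith
  rw [← h1, ← h2, add_smul, add_smul]
  abel

section Smooth

variable {A : EuclideanSpace ℝ (Fin N)} {T : ℝ} {Z : ℝ → EuclideanSpace ℝ (Fin N)}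

/-- On a compact interval where its weak order is constant, a minimizer is the hyperbolic arc with
the same endpoints: otherwise moving slightly towards that arc would decrease the action, which
there is a strictly convex quadratic functional. -/
theorem IsLocalMinimizer.eq_hyperbolicArc (hA : StrictMono fun i => A i)
    (hZ : IsLocalMinimizer A T Z) {c d : ℝ} (hc : 0 ≤ c) (hcd : c < d) (hd : d ≤ T)
    {O : Set (Fin N × Fin N)} (hO : ∀ t ∈ Icc c d, weakOrder (Z t) = O)
    {p : EuclideanSpace ℝ (Fin N)}
    (hp : ∀ t ∈ Icc c d, extendedGradient (maxCorrelation A) (Z t) = p) :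
    ∀ t ∈ Icc c d, Z t = hyperbolicArc p (Z c) (Z d) c d t := by
  set Y := hyperbolicArc p (Z c) (Z d) c d with hY
  have hcm := left_mem_Icc.2 hcd.le
  have hdm := right_mem_Icc.2 hcd.le
  have hZ1 := hZ.isH1Curve hc hcd.le hd
  have hYs : ContDiff ℝ 1 Y := (contDiff_hyperbolicArc _ _ _ _ _).of_le (mod_cast le_top)
  have hY1 : IsH1Curve Y c d := isH1Curve_of_contDiff hYs c d
  have hYc : Y c = Z c := hyperbolicArc_left hcd _ _ _
  have hYd : Y d = Z d := hyperbolicArc_right hcd _ _ _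
  have hZcont : ContinuousOn Z (Icc c d) := by
    have := hZ1.ac.continuousOn
    rwa [uIcc_of_le hcd.le] at this
  have hcluster : ∀ t ∈ Icc c d, ∀ i j, Z t i = Z t j → Y t i = Y t j := by
    intro t ht i j hij
    have hsame : ∀ s ∈ Icc c d, Z s i = Z s j := fun s hs =>
      eq_of_weakOrder_subset (by rw [hO s hs, hO t ht]) hij
    have hpij : p i = p j := by
      rw [← hp t ht]
      exact extendedGradient_eq_of_eq A hij
    simp only [hY, hyperbolicArc, PiLp.add_apply, PiLp.smul_apply, PiLp.sub_apply, hpij,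
      hsame c hcm, hsame d hdm]
  obtain ⟨ε, ⟨hεO, hε1⟩, hε0⟩ := (((eventually_weakOrder_combo hYs.continuous.continuousOn hZcont hO
    hcluster).and (mem_nhdsWithin_of_mem_nhds (Iio_mem_nhds one_pos))).and
      self_mem_nhdsWithin).exists
  have hε0 : 0 < ε := hε0
  have hε1 : ε < 1 := hε1
  set h : ℝ → EuclideanSpace ℝ (Fin N) := fun t => (1 : ℝ) • Y t + (-1 : ℝ) • Z t with hh
  have hht : ∀ t, h t = Y t - Z t := fun t => by simp [hh, sub_eq_add_neg]
  have hh1 : IsH1Curve h c d := hY1.smul_add_smul hZ1 1 (-1)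
  set W : ℝ → EuclideanSpace ℝ (Fin N) := fun t => (1 - ε) • Z t + ε • Y t with hW
  have hW1 : IsH1Curve W c d := hZ1.smul_add_smul hY1 (1 - ε) ε
  have hmin := hZ.le c d hc hcd.le hd W hW1
    (by simp only [hW, hYc, ← add_smul]; simp) (by simp only [hW, hYd, ← add_smul]; simp)
  -- the components of the arc
  set U := (Real.sinh (d - c))⁻¹ • (Z c - p) with hU
  set V := (Real.sinh (d - c))⁻¹ • (Z d - p) with hV
  have hYp : ∀ t, Y t - p = Real.sinh (d - t) • U + Real.sinh (t - c) • V := fun t => by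
    simp only [hY, hyperbolicArc, add_sub_cancel_left, hU, hV]
  have hφ1 : ∀ t : ℝ, HasDerivAt (fun t => Real.sinh (d - t)) (-Real.cosh (d - t)) t := fun t => by
    simpa using ((hasDerivAt_id t).const_sub d).sinh
  have hφ1' : ∀ t : ℝ, HasDerivAt (fun t => -Real.cosh (d - t)) (Real.sinh (d - t)) t := fun t => by
    simpa using ((hasDerivAt_id t).const_sub d).cosh.fun_neg
  have hφ2 : ∀ t : ℝ, HasDerivAt (fun t => Real.sinh (t - c)) (Real.cosh (t - c)) t := fun t => by
    simpa using ((hasDerivAt_id t).sub_const c).sinh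
  have hφ2' : ∀ t : ℝ, HasDerivAt (fun t => Real.cosh (t - c)) (Real.sinh (t - c)) t := fun t => by
    simpa using ((hasDerivAt_id t).sub_const c).cosh
  have hYder : ∀ t, HasDerivAt Y (-Real.cosh (d - t) • U + Real.cosh (t - c) • V) t := fun t =>
    (((hφ1 t).smul_const U).add ((hφ2 t).smul_const V)).const_add p
  have hhc : h c = 0 := by rw [hht, hYc, sub_self]
  have hhd : h d = 0 := by rw [hht, hYd, sub_self]
  obtain ⟨hi1, hz1⟩ := integral_inner_eq_zero_of_vanishing hh1 hhc hhd U hφ1 hφ1'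
  obtain ⟨hi2, hz2⟩ := integral_inner_eq_zero_of_vanishing hh1 hhc hhd V hφ2 hφ2'
  have hq1 : IntervalIntegrable (fun t => ‖h t‖ ^ 2) volume c d :=
    (hh1.ac.continuousOn.norm.pow 2).intervalIntegrable
  have hq := hh1.sq.add hq1
  -- expansion of the Lagrangian of `W = Z + ε h`
  have hexp : ∀ᵐ t, t ∈ uIoc c d → lagrangian A W t = lagrangian A Z t +
      2 * ε * ((-Real.cosh (d - t) * ⟪U, deriv h t⟫_ℝ + Real.sinh (d - t) * ⟪U, h t⟫_ℝ) +
        (Real.cosh (t - c) * ⟪V, deriv h t⟫_ℝ + Real.sinh (t - c) * ⟪V, h t⟫_ℝ)) +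
      (ε ^ 2 - 2 * ε) * (‖deriv h t‖ ^ 2 + ‖h t‖ ^ 2) := by
    filter_upwards [ae_differentiableAt_of_ac hZ1.ac] with t ht htm
    have hZt := (ht (uIoc_subset_uIcc htm)).hasDerivAt
    have htI : t ∈ Icc c d := by
      rw [uIoc_of_le hcd.le] at htm; exact Ioc_subset_Icc_self htm
    have hWd : HasDerivAt W ((1 - ε) • deriv Z t + ε • deriv Y t) t :=
      (hZt.const_smul (1 - ε)).add ((hYder t).differentiableAt.hasDerivAt.const_smul ε)
    have hhd' : HasDerivAt h ((1 : ℝ) • deriv Y t + (-1 : ℝ) • deriv Z t) t :=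
      ((hYder t).differentiableAt.hasDerivAt.const_smul (1 : ℝ)).add (hZt.const_smul (-1 : ℝ))
    have e1 : deriv Z t = deriv Y t - deriv h t := by rw [hhd'.deriv]; simp
    have e2 : deriv W t = deriv Y t - (1 - ε) • deriv h t := by
      rw [hWd.deriv, e1, smul_sub, sub_smul, one_smul]; abel
    have e3 : Z t - p = (Y t - p) - h t := by rw [hht]; abel
    have e4 : W t - p = (Y t - p) - (1 - ε) • h t := by
      simp only [hW, hht, smul_sub, sub_smul, one_smul]; abel
    have g1 : extendedGradient (maxCorrelation A) (W t) = p := by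
      rw [← hp t htI]
      exact extendedGradient_congr hA ((hεO t htI).trans (hO t htI).symm)
    simp only [lagrangian, ← norm_sub_extendedGradient_sq, g1, hp t htI]
    have e5 : -Real.cosh (d - t) * ⟪U, deriv h t⟫_ℝ + Real.cosh (t - c) * ⟪V, deriv h t⟫_ℝ =
        ⟪deriv Y t, deriv h t⟫_ℝ := by
      rw [(hYder t).deriv, inner_add_left, real_inner_smul_left U, real_inner_smul_left V]
    have e6 : Real.sinh (d - t) * ⟪U, h t⟫_ℝ + Real.sinh (t - c) * ⟪V, h t⟫_ℝ =
        ⟪Y t - p, h t⟫_ℝ := by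
      rw [hYp, inner_add_left, real_inner_smul_left U, real_inner_smul_left V]
    rw [e2, e1, e3, e4, norm_sub_sq_real (deriv Y t), norm_sub_sq_real (deriv Y t),
      norm_sub_sq_real (Y t - p), norm_sub_sq_real (Y t - p), norm_smul, norm_smul,
      inner_smul_right, inner_smul_right, mul_pow, mul_pow, Real.norm_eq_abs, sq_abs]
    linear_combination (-2 * ε) * e5 + (-2 * ε) * e6
  have hiZ := hZ1.intervalIntegrable_lagrangian hA
  have hint : ∫ t in c..d, lagrangian A W t = (∫ t in c..d, lagrangian A Z t) +
      (ε ^ 2 - 2 * ε) * ∫ t in c..d, (‖deriv h t‖ ^ 2 + ‖h t‖ ^ 2) := by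
    rw [intervalIntegral.integral_congr_ae hexp, intervalIntegral.integral_add
      (hiZ.add ((hi1.add hi2).const_mul _)) (hq.const_mul _), intervalIntegral.integral_add hiZ
      ((hi1.add hi2).const_mul _), intervalIntegral.integral_const_mul,
      intervalIntegral.integral_const_mul, intervalIntegral.integral_add hi1 hi2, hz1, hz2]
    ring
  rw [hint] at hmin
  have hJ : ∫ t in c..d, (‖deriv h t‖ ^ 2 + ‖h t‖ ^ 2) ≤ 0 := by
    by_contra hpos
    have := mul_pos (show 0 < 2 * ε - ε ^ 2 by nlinarith) (not_le.1 hpos)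
    linarith
  rw [intervalIntegral.integral_add hh1.sq hq1] at hJ
  have hJ2 : 0 ≤ ∫ t in c..d, ‖h t‖ ^ 2 :=
    intervalIntegral.integral_nonneg hcd.le fun _ _ => sq_nonneg _
  intro t ht
  have h1 := (hh1.norm_sub_sq_le 0 ht).2
  simp only [smul_zero, add_zero, sub_zero, hhc] at h1
  have h2 : ‖h t‖ ^ 2 ≤ 0 :=
    h1.trans (mul_nonpos_of_nonneg_of_nonpos (by linarith) (by linarith))
  have h3 : h t = 0 := by
    rw [← norm_eq_zero]
    exact pow_eq_zero_iff two_ne_zero |>.1 (le_antisymm h2 (sq_nonneg _))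
  rw [hht, sub_eq_zero] at h3
  exact h3.symm

/-- A minimizer is smooth up to the endpoints of an interval on which its weak order is constant. -/
theorem IsLocalMinimizer.contDiffOn (hA : StrictMono fun i => A i) (hZ : IsLocalMinimizer A T Z)
    {a b : ℝ} (ha : 0 ≤ a) (hab : a < b) (hb : b ≤ T)
    (hconst : ∀ r ∈ Ioo a b, ∀ s ∈ Ioo a b, weakOrder (Z r) = weakOrder (Z s)) :
    ContDiffOn ℝ ∞ Z (Icc a b) := by
  set m := a + (b - a) / 3 with hm
  set n := a + 2 * (b - a) / 3 with hn
  have hmI : m ∈ Ioo a b := ⟨by linarith, by linarith⟩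
  have hnI : n ∈ Ioo a b := ⟨by linarith, by linarith⟩
  have hmn : m < n := by linarith
  set p := extendedGradient (maxCorrelation A) (Z m) with hp
  have key : ∀ u ∈ Ioo a b, Z u = hyperbolicArc p (Z m) (Z n) m n u := by
    intro u hu
    have hc : min u m ∈ Ioo a b := ⟨lt_min hu.1 hmI.1, (min_le_left _ _).trans_lt hu.2⟩
    have hd : max u n ∈ Ioo a b := ⟨hu.1.trans_le (le_max_left _ _), max_lt hu.2 hnI.2⟩
    have hcd : min u m < max u n := (min_le_right _ _).trans_lt (hmn.trans_le (le_max_right _ _))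
    have hin : ∀ t ∈ Icc (min u m) (max u n), t ∈ Ioo a b := fun t ht =>
      ⟨hc.1.trans_le ht.1, ht.2.trans_lt hd.2⟩
    have harc := hZ.eq_hyperbolicArc hA (ha.trans hc.1.le) hcd (hd.2.le.trans hb)
      (fun t ht => hconst t (hin t ht) m hmI)
      (fun t ht => extendedGradient_congr hA (hconst t (hin t ht) m hmI))
    rw [harc m ⟨min_le_right _ _, hmn.le.trans (le_max_right _ _)⟩,
      harc n ⟨(min_le_right _ _).trans hmn.le, le_max_right _ _⟩,
      hyperbolicArc_restart _ _ _ _ _ hmn]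
    exact harc u ⟨min_le_left _ _, le_max_left _ _⟩
  have hcont : ContinuousOn Z (Icc a b) :=
    (hZ.continuousOn (ha.trans (hab.le.trans hb))).mono (Icc_subset_Icc ha hb)
  have hsm := contDiff_hyperbolicArc p (Z m) (Z n) m n
  refine hsm.contDiffOn.congr ?_
  have := (show EqOn Z (hyperbolicArc p (Z m) (Z n) m n) (Ioo a b) from key).of_subset_closure
    hcont hsm.continuous.continuousOn Ioo_subset_Icc_self (by rw [closure_Ioo hab.ne])
  exact fun t ht => this ht

end Smooth

/-! ### From global minimizers to minimizers on subintervals -/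

theorem memH1_iff {T : ℝ} (hT : 0 ≤ T) {Y : ℝ → EuclideanSpace ℝ (Fin N)} :
    MemH1 T Y ↔ IsH1Curve Y 0 T := by
  have h := memLp_two_iff_integrable_sq_norm (f := deriv Y) (μ := volume.restrict (Ioo 0 T))
    (measurable_deriv Y).aestronglyMeasurable
  rw [MemH1, h]
  change _ ∧ IntegrableOn (fun t => ‖deriv Y t‖ ^ 2) (Ioo 0 T) volume ↔ _
  rw [← intervalIntegrable_iff_integrableOn_Ioo_of_le hT]
  exact ⟨fun h => ⟨h.1, h.2⟩, fun h => ⟨h.1, h.2⟩⟩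

theorem lagrangian_eq (A : EuclideanSpace ℝ (Fin N)) (Y : ℝ → EuclideanSpace ℝ (Fin N)) (t : ℝ) :
    lagrangian A Y t =
      ‖deriv Y t‖ ^ 2 + ‖Y t - extendedGradient (maxCorrelation A) (Y t)‖ ^ 2 := by
  rw [lagrangian, norm_sub_extendedGradient_sq]

theorem lagrangian_nonneg (A : EuclideanSpace ℝ (Fin N)) (Y : ℝ → EuclideanSpace ℝ (Fin N))
    (t : ℝ) : 0 ≤ lagrangian A Y t := by
  rw [lagrangian_eq]; positivity

/-- The action of an admissible curve is finite, and is the integral of its Lagrangian. -/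
theorem action_eq_ofReal {A P Q : EuclideanSpace ℝ (Fin N)} (hA : StrictMono fun i => A i) {T : ℝ}
    (hT : 0 ≤ T) {Y : ℝ → EuclideanSpace ℝ (Fin N)} (hY : IsH1Curve Y 0 T)
    (hend : HasEndpoints P Q T Y) :
    action A P Q T Y = ENNReal.ofReal (∫ t in 0..T, lagrangian A Y t) := by
  rw [action, if_pos ⟨(memH1_iff hT).2 hY, hend⟩, intervalIntegral.integral_of_le hT,
    integral_Ioc_eq_integral_Ioo, ofReal_integral_eq_lintegral_ofReal]
  · simp only [lagrangian_eq]
  · exact (intervalIntegrable_iff_integrableOn_Ioo_of_le hT).1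
      (hY.intervalIntegrable_lagrangian hA)
  · exact Filter.Eventually.of_forall fun t => lagrangian_nonneg A Y t

theorem IsGlobalMinimizer.memH1 {A P Q : EuclideanSpace ℝ (Fin N)}
    (hA : StrictMono fun i => A i) {T : ℝ} (hT : 0 < T) {Z : ℝ → EuclideanSpace ℝ (Fin N)}
    (hZ : IsGlobalMinimizer A P Q T Z) : MemH1 T Z ∧ HasEndpoints P Q T Z := by
  by_contra hcon
  have h1 : action A P Q T Z = ⊤ := by rw [action, if_neg hcon]
  -- the segment from `P` to `Q` has finite action
  have h2 := hZ fun u => P + (u - 0) • (T⁻¹ • (Q - P))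
  rw [h1, action_eq_ofReal hA hT.le (isH1Curve_of_contDiff (contDiff_affine _ _ _) _ _)
    ⟨⟨1, by rw [permute_one]; simp⟩, ⟨1, by
      simp only [permute_one, sub_zero, smul_smul, mul_inv_cancel₀ hT.ne', one_smul]; abel⟩⟩] at h2
  exact absurd h2 (not_le.2 ENNReal.ofReal_lt_top)

theorem deriv_eq_of_eqOn_Ioo {Y W : ℝ → EuclideanSpace ℝ (Fin N)} {a b : ℝ}
    (h : EqOn W Y (Ioo a b)) {t : ℝ} (ht : t ∈ Ioo a b) : deriv W t = deriv Y t := by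
  refine Filter.EventuallyEq.deriv_eq ?_
  filter_upwards [Ioo_mem_nhds ht.1 ht.2] with s hs using h hs

theorem intervalIntegrable_deriv_sq_congr {Y W : ℝ → EuclideanSpace ℝ (Fin N)} {a b : ℝ}
    (hab : a ≤ b) (h : EqOn W Y (Ioo a b)) (hY : IsH1Curve Y a b) :
    IntervalIntegrable (fun t => ‖deriv W t‖ ^ 2) volume a b := by
  have h1 := hY.sq
  rw [intervalIntegrable_iff_integrableOn_Ioo_of_le hab] at h1 ⊢
  refine h1.congr_fun (fun t ht => ?_) measurableSet_Ioo
  simp only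
  rw [deriv_eq_of_eqOn_Ioo h ht]

theorem integral_lagrangian_congr (A : EuclideanSpace ℝ (Fin N))
    {Y W : ℝ → EuclideanSpace ℝ (Fin N)} {a b : ℝ} (hab : a ≤ b) (h : EqOn W Y (Ioo a b)) :
    ∫ t in a..b, lagrangian A W t = ∫ t in a..b, lagrangian A Y t := by
  rw [intervalIntegral.integral_of_le hab, intervalIntegral.integral_of_le hab,
    integral_Ioc_eq_integral_Ioo, integral_Ioc_eq_integral_Ioo]
  refine setIntegral_congr_fun measurableSet_Ioo fun t ht => ?_
  simp only [lagrangian, deriv_eq_of_eqOn_Ioo h ht, h ht]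

/-- A curve on `[0, T]` may be modified on a subinterval: the difference of the two curves, extended
by zero, is absolutely continuous. -/
theorem exists_glue {T c d : ℝ} (hc : 0 ≤ c) (hcd : c ≤ d) (hd : d ≤ T)
    {Y Z : ℝ → EuclideanSpace ℝ (Fin N)} (hZ : IsH1Curve Z 0 T) (hY : IsH1Curve Y c d)
    (hYc : Y c = Z c) (hYd : Y d = Z d) :
    ∃ W, IsH1Curve W 0 T ∧ EqOn W Z (Iic c) ∧ EqOn W Y (Icc c d) ∧ EqOn W Z (Ici d) := by
  have hT : 0 ≤ T := hc.trans (hcd.trans hd)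
  set φ : ℝ → ℝ := fun t => max c (min d t) with hφ
  set W : ℝ → EuclideanSpace ℝ (Fin N) := fun t => Z t + (Y (φ t) - Z (φ t)) with hW
  have hW1 : EqOn W Z (Iic c) := fun t ht => by
    have : φ t = c := max_eq_left ((min_le_right _ _).trans ht)
    simp [hW, this, hYc]
  have hW2 : EqOn W Y (Icc c d) := fun t ht => by
    have : φ t = t := by simp [hφ, ht.1, ht.2]
    simp [hW, this]
  have hW3 : EqOn W Z (Ici d) := fun t ht => by
    have : φ t = d := by simp [hφ, min_eq_left (mem_Ici.1 ht), hcd]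
    simp [hW, this, hYd]
  have hZ' : ∀ a b, 0 ≤ a → a ≤ b → b ≤ T → IsH1Curve Z a b := fun a b ha hab hb =>
    hZ.mono (by rw [uIcc_of_le hab, uIcc_of_le hT]; exact Icc_subset_Icc ha hb)
  refine ⟨W, ⟨hZ.ac.fun_add (absolutelyContinuousOnInterval_comp
    (hY.ac.fun_sub (hZ' c d hc hcd hd).ac) (φ := φ) ?_ (Or.inl ?_) ?_), ?_⟩, hW1, hW2, hW3⟩
  · exact (LipschitzWith.id.const_min d).const_max c
  · exact monotone_const.max (monotone_const.min monotone_id)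
  · intro t _
    rw [uIcc_of_le hcd]
    exact ⟨le_max_left _ _, max_le hcd (min_le_left _ _)⟩
  · have i1 := intervalIntegrable_deriv_sq_congr hc
      (fun t ht => hW1 (le_of_lt ht.2)) (hZ' 0 c le_rfl hc (hcd.trans hd))
    have i2 := intervalIntegrable_deriv_sq_congr hcd
      (fun t ht => hW2 (Ioo_subset_Icc_self ht)) hY
    have i3 := intervalIntegrable_deriv_sq_congr hd
      (fun t ht => hW3 (le_of_lt ht.1)) (hZ' d T (hc.trans hcd) hd le_rfl)
    exact (i1.trans i2).trans i3

theorem IsGlobalMinimizer.isLocalMinimizer {A P Q : EuclideanSpace ℝ (Fin N)}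
    (hA : StrictMono fun i => A i) {T : ℝ} (hT : 0 < T) {Z : ℝ → EuclideanSpace ℝ (Fin N)}
    (hZ : IsGlobalMinimizer A P Q T Z) : IsLocalMinimizer A T Z := by
  obtain ⟨hmem, hend⟩ := hZ.memH1 hA hT
  have hZ1 : IsH1Curve Z 0 T := (memH1_iff hT.le).1 hmem
  refine ⟨hZ1, fun c d hc hcd hd Y hY hYc hYd => ?_⟩
  obtain ⟨W, hW, hW1, hW2, hW3⟩ := exists_glue hc hcd hd hZ1 hY hYc hYd
  have hWend : HasEndpoints P Q T W := by
    rw [HasEndpoints, hW1 (mem_Iic.2 hc), hW3 (mem_Ici.2 hd)]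
    exact hend
  have h1 := hZ W
  rw [action_eq_ofReal hA hT.le hZ1 hend, action_eq_ofReal hA hT.le hW hWend,
    ENNReal.ofReal_le_ofReal_iff
      (intervalIntegral.integral_nonneg hT.le fun t _ => lagrangian_nonneg A W t)] at h1
  have hsplit : ∀ {X : ℝ → EuclideanSpace ℝ (Fin N)}, IsH1Curve X 0 T →
      ∫ t in 0..T, lagrangian A X t = (∫ t in 0..c, lagrangian A X t) +
        (∫ t in c..d, lagrangian A X t) + ∫ t in d..T, lagrangian A X t := by
    intro X hX
    have hi : ∀ a b, 0 ≤ a → a ≤ b → b ≤ T → IntervalIntegrable (lagrangian A X) volume a b :=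
      fun a b ha hab hb => (hX.mono (by
        rw [uIcc_of_le hab, uIcc_of_le hT.le]
        exact Icc_subset_Icc ha hb)).intervalIntegrable_lagrangian hA
    rw [intervalIntegral.integral_add_adjacent_intervals (hi 0 c le_rfl hc (hcd.trans hd))
      (hi c d hc hcd hd), intervalIntegral.integral_add_adjacent_intervals
      (hi 0 d le_rfl (hc.trans hcd) hd) (hi d T (hc.trans hcd) hd le_rfl)]
  rw [hsplit hZ1, hsplit hW,
    integral_lagrangian_congr A hc (fun t ht => hW1 (le_of_lt ht.2)),
    integral_lagrangian_congr A hcd (fun t ht => hW2 (Ioo_subset_Icc_self ht)),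
    integral_lagrangian_congr A hd (fun t ht => hW3 (le_of_lt ht.1))] at h1
  linarith

end StickyAction
end

theorem theorem4p1 (N : ℕ) (A P Q : EuclideanSpace ℝ (Fin N))
    (hA : StrictMono fun i => A i) (T : ℝ) (hT : 0 < T)
    (Z : ℝ → EuclideanSpace ℝ (Fin N))
    (hZ : StickyAction.IsGlobalMinimizer A P Q T Z) :
    ContinuousOn Z (Icc 0 T) ∧
    (∃ (p : ℕ) (t : Fin (p + 1) → ℝ), StrictMono t ∧ t 0 = 0 ∧ t (Fin.last p) = T ∧
      ∀ i : Fin p,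
        ContDiffOn ℝ ∞ Z (Icc (t i.castSucc) (t i.succ)) ∧
        ∀ r ∈ Ioo (t i.castSucc) (t i.succ), ∀ s ∈ Ioo (t i.castSucc) (t i.succ),
          StickyAction.collisionPartition (Z r) = StickyAction.collisionPartition (Z s)) ∧
    {t ∈ Icc 0 T | ∀ ε > 0, ∃ s ∈ Icc 0 T, |s - t| < ε ∧
      StickyAction.collisionPartition (Z s) ≠ StickyAction.collisionPartition (Z t)}.Finite := by
  have hloc := hZ.isLocalMinimizer hA hT
  have hfin := hloc.finite_eventTimes hA
  refine ⟨hloc.continuousOn hT.le, ?_, hfin.subset ?_⟩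
  · obtain ⟨p, t, hmono, h0, hlast, hstep⟩ :=
      StickyAction.exists_subdivision hT hfin (sep_subset _ _)
    refine ⟨p, t, hmono, h0, hlast, fun i => ?_⟩
    obtain ⟨ha, hb, hnot⟩ := hstep i
    have hconst := StickyAction.weakOrder_eq_of_disjoint_eventTimes ha hb hnot
    exact ⟨hloc.contDiffOn hA ha (hmono i.castSucc_lt_succ) hb hconst, fun r hr s hs =>
      StickyAction.collisionPartition_congr (hconst r hr s hs)⟩
  · rintro t ⟨htI, ht⟩
    refine ⟨htI, fun hev => ?_⟩
    obtain ⟨ε, hε, hsub⟩ := Metric.mem_nhdsWithin_iff.1 hev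
    obtain ⟨s, hs, hst, hne⟩ := ht ε hε
    refine hne (StickyAction.collisionPartition_congr (hsub ⟨?_, hs⟩))
    rwa [Metric.mem_ball, Real.dist_eq]
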